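/- **Setting.** Let $G=(V,E)$ be a finite simple undirected graph, $C$ a finite set of colors, $f_C:E\to 2^C$ a coloring that gives each edge a set of colors, and let $s\neq t$ be two vertices. An $st$-path is *colored by* $c\in C$ if every edge $e$ of it satisfies $c\in f_C(e)$. A *solution* of MaxCDDP (Max Colored Doubly Disjoint Path) is a set of distinct, pairwise internally vertex-disjoint $st$-paths, each assigned a color by which it is colored, where distinct paths are assigned distinct colors. MaxCDDP asks for a solution with the maximum number of paths. Let $G^{-t}$ be the subgraph of $G$ induced by $V\setminus\{t\}$. **Theorem.** MaxCDDP restricted to instances for which $G^{-t}$ is a tree is solvable in polynomial time: there are a program for a random-access machine (with addition and truncated subtraction, but no multiplication, as unit-cost arithmetic) and a polynomial $f$ such that, on the encoding of every such instance, the program outputs an optimal solution (the number of paths and, for each path, its color and its sequence of vertices) after at most $f(\ell)$ steps, where $\ell$ is the bit length of the encoding. Moreover, for each such instance, let $G_B$ be the bipartite graph with parts $N(s)=\{v:\{s,v\}\in E\}$ and $C$ in which $v\in N(s)$ and $c\in C$ are adjacent if and only if there is an $st$-path colored by $c$ whose first edge is $\{s,v\}$. Then solutions correspond to matchings of $G_B$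 of the same size: for every solution $S$, the set of pairs (second vertex of $p$, color assigned to $p$), for $p$ in $S$, is a matching of $G_B$ with $|S|$ edges, and every matching of $G_B$ arises in this way from a solution with as many paths as the matching has edges. In particular, the maximum number of paths in a solution equals the maximum size of a matching in $G_B$. -/

import Mathlib

/-! ### Random-access programs with a step count -/

namespace RAM

/-- Programs of a random-access machine over natural numbers: finitely many scalar variables and
finitely many arrays, both named by constants of the program, with assignment, addition, truncated
subtraction, indirect reading and writing, branching and loops. There is no multiplication, so one
step can at most double the largest number present. With unit-cost steps this model is therefore
polynomially equivalent to Turing machines. -/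
inductive Prog : Type
  | skip : Prog
  /-- `x := k` -/
  | const (x k : ℕ) : Prog
  /-- `x := y + z` -/
  | add (x y z : ℕ) : Prog
  /-- `x := max (y - z) 0` -/
  | sub (x y z : ℕ) : Prog
  /-- `x := a[i]`, where `a` names an array and `x`, `i` are variables -/
  | load (x a i : ℕ) : Prog
  /-- `a[i] := x`, where `a` names an array and `x`, `i` are variables -/
  | store (a i x : ℕ) : Prog
  | seq (p r : Prog) : Prog
  /-- if `x ≠ 0` then `p` else `r` -/
  | ite (x : ℕ) (p r : Prog) : Prog
  /-- while `x ≠ 0` do `p` -/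
  | loop (x : ℕ) (p : Prog) : Prog

/-- A memory state: the values of the variables and the contents of the arrays. -/
structure State where
  var : ℕ → ℕ
  arr : ℕ → ℕ → ℕ

/-- Assignment to a variable. -/
def State.setVar (σ : State) (x w : ℕ) : State :=
  { σ with var := Function.update σ.var x w }

/-- Assignment to an array cell. -/
def State.setArr (σ : State) (a i w : ℕ) : State :=
  { σ with arr := Function.update σ.arr a (Function.update (σ.arr a) i w) }

/-- `Exec p σ τ k`: started in state `σ`, the program `p` terminates in state `τ` after exactly `k`
steps, where every elementary instruction and every evaluation of a test takes one step. -/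
inductive Exec : Prog → State → State → ℕ → Prop
  | skip (σ) : Exec .skip σ σ 1
  | const (σ x k) : Exec (.const x k) σ (σ.setVar x k) 1
  | add (σ x y z) : Exec (.add x y z) σ (σ.setVar x (σ.var y + σ.var z)) 1
  | sub (σ x y z) : Exec (.sub x y z) σ (σ.setVar x (σ.var y - σ.var z)) 1
  | load (σ x a i) : Exec (.load x a i) σ (σ.setVar x (σ.arr a (σ.var i))) 1
  | store (σ a i x) : Exec (.store a i x) σ (σ.setArr a (σ.var i) (σ.var x)) 1
  | seq {p r σ τ υ k l} : Exec p σ τ k → Exec r τ υ l → Exec (.seq p r) σ υ (k + l)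
  | iteTrue {x p r σ τ k} : σ.var x ≠ 0 → Exec p σ τ k → Exec (.ite x p r) σ τ (k + 1)
  | iteFalse {x p r σ τ k} : σ.var x = 0 → Exec r σ τ k → Exec (.ite x p r) σ τ (k + 1)
  | loopDone {x p σ} : σ.var x = 0 → Exec (.loop x p) σ σ 1
  | loopStep {x p σ τ υ k l} : σ.var x ≠ 0 → Exec p σ τ k → Exec (.loop x p) τ υ l →
      Exec (.loop x p) σ υ (k + l + 1)

/-- The initial state on an input word: the input is in array `0`, its length is in variable `0`,
and everything else is `0`. -/
def initState (input : List ℕ) : State where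
  var x := if x = 0 then input.length else 0
  arr a i := if a = 0 then input.getD i 0 else 0

/-- The state `τ` presents the word `out` as output: the length of `out` is in variable `0` and its
entries are in the first cells of array `1`. -/
def Outputs (τ : State) (out : List ℕ) : Prop :=
  τ.var 0 = out.length ∧ ∀ (i : ℕ) (hi : i < out.length), τ.arr 1 i = out[i]

/-- The length in bits of a list of numbers, with one separator for each number. -/
def bitLength (l : List ℕ) : ℕ :=
  (l.map fun w => Nat.size w + 1).sum

/-- The search problem "given `a : α`, find a word `out` with `Good a out`" is solvable in
polynomial time on the inputs that satisfy `Promise`: a single program finds such a word for each of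
these inputs, in a number of steps polynomial in the bit length of the encoded input. -/
def SolvableInPolyTime {α : Type*} (encode : α → List ℕ) (Promise : α → Prop)
    (Good : α → List ℕ → Prop) : Prop :=
  ∃ (p : Prog) (f : Polynomial ℕ), ∀ a : α, Promise a →
    ∃ (τ : State) (k : ℕ) (out : List ℕ),
      Exec p (initState (encode a)) τ k ∧ k ≤ f.eval (bitLength (encode a)) ∧
        Outputs τ out ∧ Good a out

end RAM

/-! ### Edge-colored graphs and color disjoint paths -/

/-- An undirected graph on `V` in which every edge carries a finite set of colors from `C`. -/
structure EdgeColoredGraph (V C : Type*) where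
  graph : SimpleGraph V
  color : graph.edgeSet → Finset C

namespace EdgeColoredGraph

variable {V C : Type*} (G : EdgeColoredGraph V C)

/-- The path `p` is colored by `c`: every edge of `p` carries the color `c`. -/
def Colored {s t : V} (p : G.graph.Path s t) (c : C) : Prop :=
  ∀ e : G.graph.edgeSet, (e : Sym2 V) ∈ (p : G.graph.Walk s t).edges → c ∈ G.color e

/-- Two `st`-paths share no internal vertex. -/
def InternallyDisjoint {s t : V} (p r : G.graph.Path s t) : Prop :=
  ∀ v : V, v ∈ (p : G.graph.Walk s t).support → v ∈ (r : G.graph.Walk s t).support → v = s ∨ v = t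

/-- A feasible solution of MaxCDDP: a finite set of uni-color `st`-paths, each listed with one color
by which it is colored, such that the paths are pairwise distinct and internally disjoint and have
pairwise distinct colors. -/
def IsSolution {s t : V} (S : Finset (G.graph.Path s t × C)) : Prop :=
  (∀ x ∈ S, G.Colored x.1 x.2) ∧
    ∀ x ∈ S, ∀ y ∈ S, x ≠ y → x.1 ≠ y.1 ∧ x.2 ≠ y.2 ∧ G.InternallyDisjoint x.1 y.1

/-- `h` is the optimal value of MaxCDDP: the maximum number of color disjoint uni-color
`st`-paths. -/
def IsOptimum (s t : V) (h : ℕ) : Prop :=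
  IsGreatest {k | ∃ S : Finset (G.graph.Path s t × C), G.IsSolution S ∧ S.card = k} h

/-- The graph induced by the vertices other than `t`. -/
def deleteTarget (t : V) : SimpleGraph {v : V // v ∈ ({t} : Set V)ᶜ} :=
  G.graph.induce ({t} : Set V)ᶜ

/-- The bipartite graph between the neighbours of `s` and the colors, in which `v` and `c` are
adjacent if there is an `st`-path colored by `c` that goes from `s` to `v` first. -/
def matchingGraph (s t : V) : SimpleGraph (G.graph.neighborSet s ⊕ C) where
  Adj
    | .inl v, .inr c => ∃ p : G.graph.Path s t, G.Colored p c ∧ (p : G.graph.Walk s t).snd = v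
    | .inr c, .inl v => ∃ p : G.graph.Path s t, G.Colored p c ∧ (p : G.graph.Walk s t).snd = v
    | _, _ => False
  symm := ⟨by rintro (v | c) (w | d) h <;> exact h⟩
  loopless := ⟨by rintro (v | c) h <;> exact h⟩

/-- A set `S` of colored `st`-paths and a subgraph `M` of the bipartite graph correspond to each
other: the edges of `M` are the pairs of the second vertex and the color of a member of `S`. -/
def Corresponds {s t : V} (S : Finset (G.graph.Path s t × C))
    (M : (G.matchingGraph s t).Subgraph) : Prop :=
  ∀ (v : G.graph.neighborSet s) (c : C), M.Adj (.inl v) (.inr c) ↔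
    ∃ p : G.graph.Path s t, (p, c) ∈ S ∧ (p : G.graph.Walk s t).snd = v

end EdgeColoredGraph

/-! ### MaxCDDP as a computational problem -/

namespace MaxCDDP

/-- An instance of MaxCDDP: an edge-colored graph with vertices `0, …, n - 1` and colors
`0, …, q - 1`, together with two distinct vertices, the source `s` and the target `t`. -/
structure Instance where
  n : ℕ
  q : ℕ
  G : EdgeColoredGraph (Fin n) (Fin q)
  s : Fin n
  t : Fin n
  s_ne_t : s ≠ t

open Classical in
/-- The encoding of an instance: `n`, `q`, `s`, `t`, and then, for all `u` and for all `v`, a bit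
that tells whether `u` and `v` are adjacent, followed by `q` bits, one for each color, that tell
whether the edge between `u` and `v` exists and carries this color. -/
noncomputable def Instance.encode (I : Instance) : List ℕ :=
  [I.n, I.q, (I.s : ℕ), (I.t : ℕ)] ++
    (List.finRange I.n).flatMap fun u => (List.finRange I.n).flatMap fun v =>
      (if I.G.graph.Adj u v then 1 else 0) ::
        (List.finRange I.q).map fun c =>
          if ∃ h : I.G.graph.Adj u v, c ∈ I.G.color ⟨s(u, v), h⟩ then 1 else 0

/-- The encoding of a list of colored `st`-paths: the number of paths, and then, for each path, its
color, its number of vertices and its vertices in order from `s` to `t`. -/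
def Instance.encodePaths (I : Instance)
    (L : List (I.G.graph.Path I.s I.t × Fin I.q)) : List ℕ :=
  L.length :: L.flatMap fun x =>
    (x.2 : ℕ) :: (x.1 : I.G.graph.Walk I.s I.t).support.length ::
      (x.1 : I.G.graph.Walk I.s I.t).support.map fun v => (v : ℕ)

/-- The word `out` encodes an optimal solution of the instance `I`, its members listed in some
order. -/
def Instance.IsOptimalOutput (I : Instance) (out : List ℕ) : Prop :=
  ∃ (S : Finset (I.G.graph.Path I.s I.t × Fin I.q))
    (L : List (I.G.graph.Path I.s I.t × Fin I.q)),
    I.G.IsSolution S ∧ I.G.IsOptimum I.s I.t S.card ∧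
      S.val = (L : Multiset _) ∧ out = I.encodePaths L

end MaxCDDP

/-! ### A bounded-loop language and its compilation to random-access programs -/

/-! In the tree `G - t` a vertex is joined to `s` by one path only, so each internal vertex of an
`st`-path determines the second vertex of that path. Hence `st`-paths with different second vertices
are internally disjoint (`internallyDisjoint_of_snd_ne`). Conversely, distinct members of a solution
have distinct second vertices (`IsSolution.snd_ne`): a shared one could only be `t`, and then both
paths are the edge `st`. Feasibility is thus a condition on the pairs (second vertex, color), namely
that they form a matching, and a path can be chosen for each edge of a matching independently.

It remains to compute the bipartite graph and a maximum matching in it. A vertex `v` is adjacent to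
`c` iff `sv` carries `c` and `v` reaches `t` in color `c` without `s`; for each color, `n`
relaxation passes build pointers towards `t` (`findRoutes_spec`). The matching comes from an
auction: an unmatched vertex takes a cheapest adjacent color of price at most `q` from its owner and
raises that price by one. Prices never exceed `q + 1`, so there are at most `q * (q + 1)` bids. At
the end the matching is maximum (`IsAuction.card_le`): some `j` among `1, …, q + 1` is not a price.
In a competing matching, an edge whose color costs more than `j` is charged to the owner of the
color, any other edge to its own vertex, which must be matched. A held color costs at most one more
than any adjacent one, so the two kinds of charges never collide.

The algorithm is written in a language whose loops and second factors are cut off at the input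
length. A polynomial time bound then follows by structural recursion (`Stmt.exec_compile`), and only
the result of the program has to be analysed. -/

namespace RAM

/-- Expressions over a fixed input word. The second factor of a product is cut off at the length of
the input, so that a product can be computed by linearly many additions. -/
inductive Expr : Type
  | const (k : ℕ)
  | var (x : ℕ)
  | inp (e : Expr)
  | arr (a : ℕ) (e : Expr)
  | add (e f : Expr)
  | sub (e f : Expr)
  | mul (e f : Expr)

/-- The value of an expression on the input `I` of length `N`. -/
def Expr.eval (I : ℕ → ℕ) (N : ℕ) (σ : State) : Expr → ℕ
  | .const k => k
  | .var x => σ.var x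
  | .inp e => I (e.eval I N σ)
  | .arr a e => σ.arr a (e.eval I N σ)
  | .add e f => e.eval I N σ + f.eval I N σ
  | .sub e f => e.eval I N σ - f.eval I N σ
  | .mul e f => e.eval I N σ * min (f.eval I N σ) N

/-- Statements; `rep x e p` runs `p` with `x = 0, 1, …`, as often as the value of `e` tells, but at
most as often as the input is long. -/
inductive Stmt : Type
  | skip
  | set (x : ℕ) (e : Expr)
  | store (a : ℕ) (e f : Expr)
  | seq (p r : Stmt)
  | ite (e : Expr) (p r : Stmt)
  | rep (x : ℕ) (e : Expr) (p : Stmt)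

/-- The state after `m` rounds of a loop with counter `x` and body `f`. -/
def iterate (x : ℕ) (f : State → State) (σ : State) : ℕ → State
  | 0 => σ
  | m + 1 => f ((iterate x f σ m).setVar x m)

/-- The effect of a statement on the input `I` of length `N`. -/
def Stmt.eval (I : ℕ → ℕ) (N : ℕ) : Stmt → State → State
  | .skip, σ => σ
  | .set x e, σ => σ.setVar x (e.eval I N σ)
  | .store a e f, σ => σ.setArr a (e.eval I N σ) (f.eval I N σ)
  | .seq p r, σ => r.eval I N (p.eval I N σ)
  | .ite e p r, σ => if e.eval I N σ ≠ 0 then p.eval I N σ else r.eval I N σ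
  | .rep x e p, σ => iterate x (p.eval I N) σ (min (e.eval I N σ) N)

theorem Stmt.eval_seq (I : ℕ → ℕ) (N : ℕ) (p r : Stmt) (σ : State) :
    (Stmt.seq p r).eval I N σ = r.eval I N (p.eval I N σ) := rfl

theorem Stmt.eval_rep (I : ℕ → ℕ) (N x : ℕ) (e : Expr) (p : Stmt) (σ : State) :
    (Stmt.rep x e p).eval I N σ = iterate x (p.eval I N) σ (min (e.eval I N σ) N) := rfl

/-- The invariant rule for bounded loops; `k` is the number of completed rounds. Each round sets the
counter anew, so the body is free to overwrite it. -/
theorem iterate_induction {x : ℕ} {f : State → State} {σ : State} {m : ℕ}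
    (P : ℕ → State → Prop) (zero : P 0 σ)
    (step : ∀ k < m, ∀ τ, P k τ → P (k + 1) (f (τ.setVar x k))) :
    P m (iterate x f σ m) := by
  suffices ∀ k ≤ m, P k (iterate x f σ k) from this m le_rfl
  intro k hk
  induction k with
  | zero => exact zero
  | succ k ih => exact step k hk _ (ih (by omega))

/-! ### Translation into machine programs, with cost bounds -/

/-- The variable of the machine that holds the variable `x`. -/
def userVar (x : ℕ) : ℕ := 2 * x + 2

/-- The `d`-th auxiliary variable of the machine. -/
def tempVar (d : ℕ) : ℕ := 2 * d + 3

@[simp] theorem userVar_inj {x y : ℕ} : userVar x = userVar y ↔ x = y := by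
  simp [userVar]

@[simp] theorem tempVar_inj {d e : ℕ} : tempVar d = tempVar e ↔ d = e := by
  simp [tempVar]

@[simp] theorem tempVar_ne_userVar (d x : ℕ) : tempVar d ≠ userVar x := by
  simp only [tempVar, userVar]
  omega

@[simp] theorem userVar_ne_tempVar (x d : ℕ) : userVar x ≠ tempVar d :=
  (tempVar_ne_userVar d x).symm

@[simp] theorem userVar_ne_zero (x : ℕ) : userVar x ≠ 0 := by
  simp [userVar]

@[simp] theorem userVar_ne_one (x : ℕ) : userVar x ≠ 1 := by
  simp only [userVar]
  omega

@[simp] theorem one_ne_tempVar (d : ℕ) : 1 ≠ tempVar d := by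
  simp only [tempVar]
  omega

@[simp] theorem one_ne_userVar (x : ℕ) : 1 ≠ userVar x :=
  (userVar_ne_one x).symm

/-- A program that stores the value of an expression in the `d`-th auxiliary variable, and changes
only this and later auxiliary variables. -/
def Expr.compile : ℕ → Expr → Prog
  | d, .const k => .const (tempVar d) k
  | d, .var x => .seq (.const (tempVar d) 0) (.add (tempVar d) (tempVar d) (userVar x))
  | d, .inp e => .seq (e.compile d) (.load (tempVar d) 0 (tempVar d))
  | d, .arr a e => .seq (e.compile d) (.load (tempVar d) (a + 1) (tempVar d))
  | d, .add e f => .seq (e.compile d) (.seq (f.compile (d + 1))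
      (.add (tempVar d) (tempVar d) (tempVar (d + 1))))
  | d, .sub e f => .seq (e.compile d) (.seq (f.compile (d + 1))
      (.sub (tempVar d) (tempVar d) (tempVar (d + 1))))
  | d, .mul e f => .seq (e.compile d) (.seq (f.compile (d + 1))
      -- Variable `1` holds `N`, and `a - (a - N) = min a N`. The product accumulates in `tempVar (d
      -- + 2)`; `tempVar (d + 3)` is the decrement `1`.
      (.seq (.sub (tempVar (d + 2)) (tempVar (d + 1)) 1)
      (.seq (.sub (tempVar (d + 1)) (tempVar (d + 1)) (tempVar (d + 2)))
      (.seq (.const (tempVar (d + 2)) 0)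
      (.seq (.const (tempVar (d + 3)) 1)
      (.seq (.loop (tempVar (d + 1))
        (.seq (.add (tempVar (d + 2)) (tempVar (d + 2)) (tempVar d))
          (.sub (tempVar (d + 1)) (tempVar (d + 1)) (tempVar (d + 3)))))
      (.seq (.const (tempVar (d + 3)) 0)
        (.add (tempVar d) (tempVar (d + 2)) (tempVar (d + 3))))))))))

/-- A program that has the effect of a statement and spares the auxiliary variables below `d`. -/
def Stmt.compile : ℕ → Stmt → Prog
  | _, .skip => .skip
  | d, .set x e => .seq (e.compile d) (.seq (.const (userVar x) 0)
      (.add (userVar x) (userVar x) (tempVar d)))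
  | d, .store a e f => .seq (e.compile d) (.seq (f.compile (d + 1))
      (.store (a + 1) (tempVar d) (tempVar (d + 1))))
  | d, .seq p r => .seq (p.compile d) (r.compile d)
  | d, .ite e p r => .seq (e.compile d) (.ite (tempVar d) (p.compile d) (r.compile d))
  | d, .rep x e p => .seq (e.compile d)
      -- `tempVar d` becomes the number of remaining rounds, again as `a - (a - N)`, and `tempVar (d
      -- + 1)` the index of the round. The body is compiled at `d + 2` and spares both.
      (.seq (.sub (tempVar (d + 1)) (tempVar d) 1)
      (.seq (.sub (tempVar d) (tempVar d) (tempVar (d + 1)))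
      (.seq (.const (tempVar (d + 1)) 0)
      (.loop (tempVar d)
        (.seq (.const (tempVar (d + 2)) 0)
        (.seq (.add (userVar x) (tempVar (d + 1)) (tempVar (d + 2)))
        (.seq (p.compile (d + 2))
        (.seq (.const (tempVar (d + 2)) 1)
        (.seq (.add (tempVar (d + 1)) (tempVar (d + 1)) (tempVar (d + 2)))
          (.sub (tempVar d) (tempVar d) (tempVar (d + 2))))))))))))

open Polynomial in
/-- A bound on the running time of the compiled expression, in the length of the input. -/
noncomputable def Expr.cost : Expr → ℕ[X]
  | .const _ => 1
  | .var _ => 2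
  | .inp e => e.cost + 1
  | .arr _ e => e.cost + 1
  | .add e f => e.cost + f.cost + 1
  | .sub e f => e.cost + f.cost + 1
  | .mul e f => e.cost + f.cost + 3 * X + 7

open Polynomial in
/-- A bound on the running time of the compiled statement, in the length of the input. -/
noncomputable def Stmt.cost : Stmt → ℕ[X]
  | .skip => 1
  | .set _ e => e.cost + 2
  | .store _ e f => e.cost + f.cost + 1
  | .seq p r => p.cost + r.cost
  | .ite e p r => e.cost + p.cost + r.cost + 1
  | .rep _ e p => e.cost + 4 + X * (p.cost + 6)

/-! ### Correctness and running time of the translation -/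

/-- The machine state `σ` represents the state `h` on the input `I` of length `N`. -/
structure Represents (I : ℕ → ℕ) (N : ℕ) (h σ : State) : Prop where
  len : σ.var 1 = N
  var : ∀ x, σ.var (userVar x) = h.var x
  inp : σ.arr 0 = I
  arr : ∀ a, σ.arr (a + 1) = h.arr a

@[simp] theorem State.setVar_var (σ : State) (x w y : ℕ) :
    (σ.setVar x w).var y = if y = x then w else σ.var y := by
  simp [State.setVar, Function.update_apply]

@[simp] theorem State.setVar_arr (σ : State) (x w : ℕ) : (σ.setVar x w).arr = σ.arr := rfl

@[simp] theorem State.setArr_var (σ : State) (a i w : ℕ) : (σ.setArr a i w).var = σ.var := rfl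

theorem State.setArr_arr (σ : State) (a i w b : ℕ) :
    (σ.setArr a i w).arr b = if b = a then Function.update (σ.arr a) i w else σ.arr b := by
  simp [State.setArr, Function.update_apply]

theorem Represents.setTemp {I : ℕ → ℕ} {N : ℕ} {h σ : State} (H : Represents I N h σ)
    (d w : ℕ) : Represents I N h (σ.setVar (tempVar d) w) := by
  refine ⟨?_, fun x => ?_, H.inp, H.arr⟩
  · simpa using H.len
  · simpa using H.var x

theorem Represents.setUser {I : ℕ → ℕ} {N : ℕ} {h σ : State} (H : Represents I N h σ)
    (x w : ℕ) : Represents I N (h.setVar x w) (σ.setVar (userVar x) w) := by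
  refine ⟨?_, fun y => ?_, H.inp, H.arr⟩
  · simpa using H.len
  · simp [H.var y]

theorem Represents.setArr {I : ℕ → ℕ} {N : ℕ} {h σ : State} (H : Represents I N h σ)
    (a i w : ℕ) : Represents I N (h.setArr a i w) (σ.setArr (a + 1) i w) := by
  refine ⟨H.len, H.var, ?_, fun b => ?_⟩
  · simpa [State.setArr, Function.update_apply] using H.inp
  · simp [State.setArr, Function.update_apply, H.arr]

/-- The loop that computes products by repeated addition. -/
theorem exec_mulLoop {I : ℕ → ℕ} {N : ℕ} {h : State} (d m : ℕ) : ∀ σ : State,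
    Represents I N h σ → σ.var (tempVar (d + 1)) = m → σ.var (tempVar (d + 3)) = 1 →
    ∃ τ, Exec (.loop (tempVar (d + 1))
        (.seq (.add (tempVar (d + 2)) (tempVar (d + 2)) (tempVar d))
          (.sub (tempVar (d + 1)) (tempVar (d + 1)) (tempVar (d + 3))))) σ τ (3 * m + 1) ∧
      Represents I N h τ ∧
      τ.var (tempVar (d + 2)) = σ.var (tempVar (d + 2)) + σ.var (tempVar d) * m ∧
      ∀ j < d, τ.var (tempVar j) = σ.var (tempVar j) := by
  induction m with
  | zero => exact fun σ H h1 h3 => ⟨σ, .loopDone h1, H, by simp, fun j _ => rfl⟩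
  | succ m ih =>
    intro σ H h1 h3
    obtain ⟨τ, hτ, H', hv, hj⟩ := ih
      ((σ.setVar (tempVar (d + 2)) (σ.var (tempVar (d + 2)) + σ.var (tempVar d))).setVar
        (tempVar (d + 1)) m) ((H.setTemp _ _).setTemp _ _) (by simp) (by simpa using h3)
    refine ⟨τ, ?_, H', ?_, fun j hjd => ?_⟩
    · have := Exec.loopStep (x := tempVar (d + 1)) (by omega)
        (.seq (.add σ (tempVar (d + 2)) (tempVar (d + 2)) (tempVar d))
          (.sub _ (tempVar (d + 1)) (tempVar (d + 1)) (tempVar (d + 3)))) (by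
          convert hτ using 2
          simp [h1, h3])
      convert this using 1
      omega
    · rw [hv]
      simp
      ring
    · rw [hj j hjd]
      simp [show j ≠ d + 1 by omega, show j ≠ d + 2 by omega]

/-- The last clause carries the induction: it keeps the left operand in `tempVar d` intact while the
right one is computed from `d + 1` on. -/
theorem Expr.exec_compile {I : ℕ → ℕ} {N : ℕ} {h : State} (e : Expr) : ∀ (d : ℕ) (σ : State),
    Represents I N h σ → ∃ τ k, Exec (e.compile d) σ τ k ∧ k ≤ e.cost.eval N ∧
      Represents I N h τ ∧ τ.var (tempVar d) = e.eval I N h ∧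
      ∀ j < d, τ.var (tempVar j) = σ.var (tempVar j) := by
  induction e with
  | const k =>
    intro d σ H
    refine ⟨_, 1, .const _ _ _, by simp [cost], H.setTemp _ _, by simp [eval], fun j hj => ?_⟩
    simp [hj.ne]
  | var x =>
    intro d σ H
    refine ⟨_, _, .seq (.const _ _ _) (.add _ _ _ _), by simp [cost],
      (H.setTemp _ _).setTemp _ _, ?_, fun j hj => ?_⟩
    · have := H.var x
      simp [eval, this]
    · simp [hj.ne]
  | inp e ih =>
    intro d σ H
    obtain ⟨τ, k, h1, h2, h3, h4, h5⟩ := ih d σ H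
    refine ⟨_, _, .seq h1 (.load _ _ _ _), by simp [cost, h2], h3.setTemp _ _, ?_, fun j hj => ?_⟩
    · simp [eval, h3.inp, h4]
    · simp [hj.ne, h5 j hj]
  | arr a e ih =>
    intro d σ H
    obtain ⟨τ, k, h1, h2, h3, h4, h5⟩ := ih d σ H
    refine ⟨_, _, .seq h1 (.load _ _ _ _), by simp [cost, h2], h3.setTemp _ _, ?_, fun j hj => ?_⟩
    · simp [eval, h3.arr, h4]
    · simp [hj.ne, h5 j hj]
  | add e f ihe ihf =>
    intro d σ H
    obtain ⟨τ, k, h1, h2, h3, h4, h5⟩ := ihe d σ H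
    obtain ⟨υ, l, g1, g2, g3, g4, g5⟩ := ihf (d + 1) τ h3
    refine ⟨_, _, .seq h1 (.seq g1 (.add _ _ _ _)), by simp [cost]; omega, g3.setTemp _ _, ?_,
      fun j hj => ?_⟩
    · simp [eval, g5 d, h4, g4]
    · simp [hj.ne, h5 j hj, g5 j (by omega)]
  | sub e f ihe ihf =>
    intro d σ H
    obtain ⟨τ, k, h1, h2, h3, h4, h5⟩ := ihe d σ H
    obtain ⟨υ, l, g1, g2, g3, g4, g5⟩ := ihf (d + 1) τ h3
    refine ⟨_, _, .seq h1 (.seq g1 (.sub _ _ _ _)), by simp [cost]; omega, g3.setTemp _ _, ?_,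
      fun j hj => ?_⟩
    · simp [eval, g5 d, h4, g4]
    · simp [hj.ne, h5 j hj, g5 j (by omega)]
  | mul e f ihe ihf =>
    intro d σ H
    obtain ⟨τ, k, h1, h2, h3, h4, h5⟩ := ihe d σ H
    obtain ⟨υ, l, g1, g2, g3, g4, g5⟩ := ihf (d + 1) τ h3
    obtain ⟨φ, f1, f2, f3, f4⟩ := exec_mulLoop (I := I) (N := N) (h := h) d
      (min (f.eval I N h) N)
      ((((υ.setVar (tempVar (d + 2)) (υ.var (tempVar (d + 1)) - υ.var 1)).setVar
        (tempVar (d + 1)) (min (f.eval I N h) N)).setVar (tempVar (d + 2)) 0).setVar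
        (tempVar (d + 3)) 1)
      ((((g3.setTemp _ _).setTemp _ _).setTemp _ _).setTemp _ _) (by simp) (by simp)
    refine ⟨_, _, .seq h1 (.seq g1 (.seq (.sub _ _ _ _) (.seq (.sub _ _ _ _)
      (.seq (.const _ _ _) (.seq (.const _ _ _) (.seq (τ := φ) (k := ?_) ?_
        (.seq (.const _ _ _) (.add _ _ _ _)))))))), ?_, (f2.setTemp _ _).setTemp _ _, ?_,
      fun j hj => ?_⟩
    · exact 3 * min (f.eval I N h) N + 1
    · convert f1 using 4
      simp [g4, g3.len]
      omega
    · simp [cost]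
      omega
    · simp [eval, f3, g5 d, h4]
    · simp [hj.ne, f4 j hj, h5 j hj, g5 j (by omega), show j ≠ d + 1 by omega,
        show j ≠ d + 2 by omega, show j ≠ d + 3 by omega]

/-- Here the last clause protects the counters of the enclosing loops. -/
theorem Stmt.exec_compile {I : ℕ → ℕ} {N : ℕ} (p : Stmt) : ∀ (d : ℕ) (h σ : State),
    Represents I N h σ → ∃ τ k, Exec (p.compile d) σ τ k ∧ k ≤ p.cost.eval N ∧
      Represents I N (p.eval I N h) τ ∧ ∀ j < d, τ.var (tempVar j) = σ.var (tempVar j) := by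
  induction p with
  | skip => exact fun d h σ H => ⟨σ, 1, .skip σ, by simp [cost], H, fun _ _ => rfl⟩
  | set x e =>
    intro d h σ H
    obtain ⟨τ, k, h1, h2, h3, h4, h5⟩ := e.exec_compile d σ H
    refine ⟨(τ.setVar (userVar x) 0).setVar (userVar x) (e.eval I N h), _, .seq h1
      (.seq (.const _ _ _) (l := 1) ?_), ?_, ?_, fun j hj => ?_⟩
    · convert Exec.add _ (userVar x) (userVar x) (tempVar d) using 2
      simp [← h4]
    · simp [cost]; omega
    · have := h3.setUser x (e.eval I N h)
      have e2 : (τ.setVar (userVar x) 0).setVar (userVar x) (e.eval I N h) =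
        τ.setVar (userVar x) (e.eval I N h) := by simp [State.setVar]
      rw [e2]
      exact this
    · simp [h5 j hj]
  | store a e f =>
    intro d h σ H
    obtain ⟨τ, k, h1, h2, h3, h4, h5⟩ := e.exec_compile d σ H
    obtain ⟨υ, l, g1, g2, g3, g4, g5⟩ := f.exec_compile (d + 1) τ h3
    refine ⟨_, _, .seq h1 (.seq g1 (.store _ _ _ _)), by simp [cost]; omega, ?_, fun j hj => ?_⟩
    · rw [g4, g5 d (by omega), h4]
      exact g3.setArr _ _ _
    · simp [h5 j hj, g5 j (by omega)]
  | seq p r ihp ihr =>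
    intro d h σ H
    obtain ⟨τ, k, h1, h2, h3, h4⟩ := ihp d h σ H
    obtain ⟨υ, l, g1, g2, g3, g4⟩ := ihr d _ τ h3
    exact ⟨_, _, .seq h1 g1, by simp [cost]; omega, g3, fun j hj => (g4 j hj).trans (h4 j hj)⟩
  | ite e p r ihp ihr =>
    intro d h σ H
    obtain ⟨τ, k, h1, h2, h3, h4, h5⟩ := e.exec_compile d σ H
    by_cases he : e.eval I N h = 0
    · obtain ⟨υ, l, g1, g2, g3, g4⟩ := ihr d h τ h3
      exact ⟨_, _, .seq h1 (.iteFalse (h4.trans he) g1), by simp [cost]; omega,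
        by simpa [eval, he] using g3, fun j hj => (g4 j hj).trans (h5 j hj)⟩
    · obtain ⟨υ, l, g1, g2, g3, g4⟩ := ihp d h τ h3
      exact ⟨_, _, .seq h1 (.iteTrue (by rwa [h4]) g1), by simp [cost]; omega,
        by simpa [eval, he] using g3, fun j hj => (g4 j hj).trans (h5 j hj)⟩
  | rep x e p ih =>
    intro d h σ H
    obtain ⟨τ, k, h1, h2, h3, h4, h5⟩ := e.exec_compile d σ H
    -- `m` rounds remain and `i` are done. Besides its body, a round takes five elementary
    -- instructions and one test.
    have key : ∀ m i : ℕ, ∀ υ : State, Represents I N (iterate x (p.eval I N) h i) υ →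
        υ.var (tempVar d) = m → υ.var (tempVar (d + 1)) = i →
        ∃ φ l, Exec (.loop (tempVar d)
          (.seq (.const (tempVar (d + 2)) 0)
          (.seq (.add (userVar x) (tempVar (d + 1)) (tempVar (d + 2)))
          (.seq (p.compile (d + 2))
          (.seq (.const (tempVar (d + 2)) 1)
          (.seq (.add (tempVar (d + 1)) (tempVar (d + 1)) (tempVar (d + 2)))
            (.sub (tempVar d) (tempVar d) (tempVar (d + 2))))))))) υ φ l ∧
          l ≤ m * (p.cost.eval N + 6) + 1 ∧
          Represents I N (iterate x (p.eval I N) h (i + m)) φ ∧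
          ∀ j < d, φ.var (tempVar j) = υ.var (tempVar j) := by
      intro m
      induction m with
      | zero => exact fun i υ H h1 h2 => ⟨υ, 1, .loopDone h1, by simp, H, fun _ _ => rfl⟩
      | succ m ihm =>
        intro i υ H v1 v2
        obtain ⟨ψ, l, g1, g2, g3, g4⟩ := ih (d + 2) _ _
          ((H.setTemp (d + 2) 0).setUser x i)
        obtain ⟨φ, r, f1, f2, f3, f4⟩ := ihm (i + 1)
          (((ψ.setVar (tempVar (d + 2)) 1).setVar (tempVar (d + 1)) (i + 1)).setVar
            (tempVar d) m) (((g3.setTemp _ _).setTemp _ _).setTemp _ _) (by simp) (by simp)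
        have w1 := g4 (d + 1) (by omega)
        have w2 := g4 d (by omega)
        simp [v1, v2] at w1 w2
        refine ⟨φ, _, .loopStep (by omega) (.seq (.const _ _ _)
          (.seq (.add _ _ _ _) (.seq (τ := ψ) (k := l) ?_ (.seq (.const _ _ _)
          (.seq (.add _ _ _ _) (.sub _ _ _ _)))))) (υ := φ) (l := r) ?_, ?_, ?_, ?_⟩
        · convert g1 using 2
          simp [v2]
        · convert f1 using 2
          · congr 1
            simp [w1]
          · simp [w2]
        · rw [add_mul]
          omega
        · rw [← add_assoc, add_right_comm]
          exact f3
        · intro j hj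
          rw [f4 j hj]
          have := g4 j (by omega)
          simp [show j ≠ d + 2 by omega] at this
          simp [this, show j ≠ d by omega, show j ≠ d + 1 by omega, show j ≠ d + 2 by omega]
    obtain ⟨φ, l, g1, g2, g3, g4⟩ := key (min (e.eval I N h) N) 0
      (((τ.setVar (tempVar (d + 1)) (τ.var (tempVar d) - τ.var 1)).setVar (tempVar d)
        (min (e.eval I N h) N)).setVar (tempVar (d + 1)) 0)
      (((h3.setTemp _ _).setTemp _ _).setTemp _ _) (by simp) (by simp)
    refine ⟨φ, _, .seq h1 (.seq (.sub _ _ _ _) (.seq (.sub _ _ _ _) (.seq (.const _ _ _)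
      (k := 1) (l := l) ?_))), ?_, ?_, ?_⟩
    · convert g1 using 3
      simp [h4, h3.len]
      omega
    -- The cut-off turns the number of rounds into the factor `X`. The summand `4` pays for three
    -- instructions and the final test.
    · have := Nat.mul_le_mul_right (p.cost.eval N + 6) (min_le_right (e.eval I N h) N)
      simp only [cost, Polynomial.eval_add, Polynomial.eval_mul, Polynomial.eval_X,
        Polynomial.eval_ofNat]
      omega
    · rw [zero_add] at g3
      exact g3
    · intro j hj
      rw [g4 j hj]
      simp [h5 j hj, show j ≠ d by omega, show j ≠ d + 1 by omega]

theorem eval_monotone (f : Polynomial ℕ) : Monotone fun x : ℕ => f.eval x := by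
  intro x y hxy
  simp only [Polynomial.eval_eq_sum_range]
  gcongr

theorem length_le_bitLength (l : List ℕ) : l.length ≤ bitLength l := by
  induction l with
  | nil => simp
  | cons a l ih =>
    simp only [bitLength, List.map_cons, List.sum_cons, List.length_cons] at ih ⊢
    omega

/-- The state with all variables and array cells zero. -/
def zeroState : State := ⟨fun _ => 0, fun _ _ => 0⟩

/-- A search problem is solvable in polynomial time if a statement of the bounded-loop language
solves it, leaving the length of the output in variable `0` and the output in array `0`. -/
theorem solvableInPolyTime_of_stmt {α : Type*} {encode : α → List ℕ} {Promise : α → Prop}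
    {Good : α → List ℕ → Prop} (p : Stmt)
    (hp : ∀ a, Promise a → ∃ out, Good a out ∧
      (p.eval (fun i => (encode a).getD i 0) (encode a).length zeroState).var 0 = out.length ∧
      ∀ (i : ℕ) (hi : i < out.length),
        (p.eval (fun i => (encode a).getD i 0) (encode a).length zeroState).arr 0 i = out[i]) :
    SolvableInPolyTime encode Promise Good := by
  -- Variable `1` is initially zero and receives the input length. Array `0` of the language is
  -- array `1` of the machine, so at the end only the output length has to be copied.
  refine ⟨.seq (.add 1 0 1) (.seq (.const 0 0) (.seq (p.compile 0)
    (.seq (.const 0 0) (.add 0 0 (userVar 0))))), p.cost + 4, fun a ha => ?_⟩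
  obtain ⟨out, hout, h0, h1⟩ := hp a ha
  have R : Represents (fun i => (encode a).getD i 0) (encode a).length zeroState
      (((initState (encode a)).setVar 1 (encode a).length).setVar 0 0) := by
    refine ⟨by simp, fun x => by simp [initState, zeroState], ?_, fun b => ?_⟩
    · funext i
      simp [initState]
    · funext i
      simp [initState, zeroState]
  obtain ⟨τ, k, g1, g2, g3, -⟩ := p.exec_compile 0 _ _ R
  refine ⟨_, _, out, .seq (.add _ _ _ _) (.seq (.const _ _ _) (.seq (k := k) (τ := τ) ?_
    (.seq (.const _ _ _) (.add _ _ _ _)))), ?_, ⟨?_, ?_⟩, hout⟩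
  · convert g1 using 3
    simp [initState]
  -- The cost is a polynomial in the number of input entries, which is at most the bit length.
  · have := eval_monotone p.cost (length_le_bitLength (encode a))
    simp only [Polynomial.eval_add, Polynomial.eval_ofNat] at this ⊢
    omega
  · simpa [g3.var 0] using h0
  · intro i hi
    exact (congrFun (g3.arr 0) i).trans (h1 i hi)

/-! ### Frame rules -/

/-- The statement may change the variable `x`. -/
def Stmt.setsVar (x : ℕ) : Stmt → Bool
  | .set y _ => y == x
  | .seq p r => p.setsVar x || r.setsVar x
  | .ite _ p r => p.setsVar x || r.setsVar x
  | .rep y _ p => y == x || p.setsVar x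
  | _ => false

/-- The statement may change the array `a`. -/
def Stmt.setsArr (a : ℕ) : Stmt → Bool
  | .store b _ _ => b == a
  | .seq p r => p.setsArr a || r.setsArr a
  | .ite _ p r => p.setsArr a || r.setsArr a
  | .rep _ _ p => p.setsArr a
  | _ => false

/-- The hypothesis is a syntactic check that `rfl` decides for concrete programs, so preservation of
a variable needs no look at what the program computes. -/
theorem Stmt.eval_var {I : ℕ → ℕ} {N x : ℕ} (p : Stmt) : p.setsVar x = false → ∀ σ,
    (p.eval I N σ).var x = σ.var x := by
  induction p with
  | skip => exact fun _ _ => rfl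
  | set y e => intro h σ; simp [setsVar] at h; simp [eval, Ne.symm h]
  | store => exact fun _ _ => rfl
  | seq p r ihp ihr => intro h σ; simp [setsVar] at h; simp [eval, ihp h.1, ihr h.2]
  | ite e p r ihp ihr =>
    intro h σ; simp [setsVar] at h; by_cases he : e.eval I N σ = 0 <;>
      simp [eval, he, ihp h.1, ihr h.2]
  | rep y e p ih =>
    intro h σ
    simp [setsVar] at h
    exact iterate_induction (fun _ τ => τ.var x = σ.var x) rfl fun k _ τ hτ => by
      simp [ih h.2, Ne.symm h.1, hτ]

theorem Stmt.eval_arr {I : ℕ → ℕ} {N a : ℕ} (p : Stmt) : p.setsArr a = false → ∀ σ,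
    (p.eval I N σ).arr a = σ.arr a := by
  induction p with
  | skip => exact fun _ _ => rfl
  | set y e => exact fun _ _ => rfl
  | store b e f => intro h σ; simp [setsArr] at h; simp [eval, State.setArr_arr, Ne.symm h]
  | seq p r ihp ihr => intro h σ; simp [setsArr] at h; simp [eval, ihp h.1, ihr h.2]
  | ite e p r ihp ihr =>
    intro h σ; simp [setsArr] at h; by_cases he : e.eval I N σ = 0 <;>
      simp [eval, he, ihp h.1, ihr h.2]
  | rep y e p ih =>
    intro h σ
    simp [setsArr] at h
    exact iterate_induction (fun _ τ => τ.arr a = σ.arr a) rfl fun k _ τ hτ => by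
      simp [ih h, hτ]

end RAM

/-! ### Solutions and matchings -/

namespace EdgeColoredGraph

variable {V C : Type*} {G : EdgeColoredGraph V C} {s t : V}

theorem adj_snd (hst : s ≠ t) (p : G.graph.Path s t) :
    G.graph.Adj s (p : G.graph.Walk s t).snd :=
  SimpleGraph.Walk.adj_snd (SimpleGraph.Walk.not_nil_of_ne hst)

/-- After its first step such a path is a path from `t` to `t`, hence ends there. Both supports are
`[s, t]`, and the support determines the walk. -/
theorem eq_of_snd_eq_target (hst : s ≠ t) {p r : G.graph.Path s t}
    (hp : (p : G.graph.Walk s t).snd = t) (hr : (r : G.graph.Walk s t).snd = t) : p = r := by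
  have key : ∀ (p : G.graph.Walk s t), p.IsPath → p.snd = t → p.support = [s, t] := by
    intro p hp h
    cases p with
    | nil => exact absurd rfl hst
    | cons a p =>
      rw [SimpleGraph.Walk.snd_cons] at h
      subst h
      have := ((SimpleGraph.Walk.isPath_iff_nil).1 ((SimpleGraph.Walk.cons_isPath_iff _ _).1 hp).1)
      simp [SimpleGraph.Walk.nil_iff_support_eq.1 this]
  exact Subtype.ext (SimpleGraph.Walk.ext_support
    ((key _ p.2 hp).trans (key _ r.2 hr).symm))

/-- Distinct members of a solution have distinct second vertices. -/
theorem IsSolution.snd_ne (hst : s ≠ t) {S : Finset (G.graph.Path s t × C)}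
    (hS : G.IsSolution S) {x y : G.graph.Path s t × C} (hx : x ∈ S) (hy : y ∈ S) (hxy : x ≠ y) :
    (x.1 : G.graph.Walk s t).snd ≠ (y.1 : G.graph.Walk s t).snd := by
  intro h
  obtain ⟨h1, -, h3⟩ := hS.2 x hx y hy hxy
  -- The common second vertex lies on both paths, so disjointness leaves only `s` and `t`.
  rcases h3 _ (SimpleGraph.Walk.getVert_mem_support _ 1)
    (h.symm ▸ SimpleGraph.Walk.getVert_mem_support (y.1 : G.graph.Walk s t) 1 :
      (x.1 : G.graph.Walk s t).snd ∈ _) with h4 | h4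
  · exact (adj_snd hst x.1).ne h4.symm
  · exact h1 (eq_of_snd_eq_target hst h4 (h ▸ h4))

/-- If the graph without the target is a tree, then paths that leave the source in different
directions are internally disjoint. -/
theorem internallyDisjoint_of_snd_ne (hT : (G.deleteTarget t).IsTree) (hst : s ≠ t)
    {p r : G.graph.Path s t}
    (h : (p : G.graph.Walk s t).snd ≠ (r : G.graph.Walk s t).snd) : G.InternallyDisjoint p r := by
  classical
  intro v hp hr
  by_contra! hv
  -- The part of a path up to `v ≠ t` avoids the endpoint `t`, so it lives in the tree; it keeps the
  -- second vertex because `v ≠ s`.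
  have key : ∀ (p : G.graph.Path s t) (hp : v ∈ (p : G.graph.Walk s t).support),
      ∃ q : (G.deleteTarget t).Path ⟨s, hst⟩ ⟨v, hv.2⟩,
        (q : (G.deleteTarget t).Walk ⟨s, hst⟩ ⟨v, hv.2⟩).snd.1 = (p : G.graph.Walk s t).snd := by
    intro p hp
    have hsub : ∀ x ∈ ((p : G.graph.Walk s t).takeUntil v hp).support, x ∈ ({t} : Set V)ᶜ := by
      rintro x hx rfl
      exact SimpleGraph.Walk.endpoint_notMem_support_takeUntil p.2 hp hv.2.symm hx
    have hpath := SimpleGraph.Walk.IsPath.takeUntil p.2 hp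
    have hm := SimpleGraph.Walk.map_induce _ hsub
    refine ⟨⟨((p : G.graph.Walk s t).takeUntil v hp).induce _ hsub, ?_⟩, ?_⟩
    · rw [← hm] at hpath
      exact hpath.of_map
    · rw [← SimpleGraph.Walk.snd_takeUntil hv.1 _ hp]
      conv_rhs => rw [← hm]
      exact (SimpleGraph.Walk.getVert_map (SimpleGraph.Embedding.induce ({t}ᶜ : Set V)).toHom
        (((p : G.graph.Walk s t).takeUntil v hp).induce _ hsub) 1).symm
  obtain ⟨q, hq⟩ := key p hp
  obtain ⟨q', hq'⟩ := key r hr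
  -- Paths between two given vertices of an acyclic graph coincide.
  rw [← hq, ← hq', (hT.isAcyclic.subsingleton_path _ _).elim q q'] at h
  exact h rfl

/-- A set of colored paths is a solution if its members have distinct second vertices and distinct
colors. -/
theorem isSolution_of_snd_ne (hT : (G.deleteTarget t).IsTree) (hst : s ≠ t)
    {S : Finset (G.graph.Path s t × C)} (hc : ∀ x ∈ S, G.Colored x.1 x.2)
    (hS : ∀ x ∈ S, ∀ y ∈ S, x ≠ y →
      (x.1 : G.graph.Walk s t).snd ≠ (y.1 : G.graph.Walk s t).snd ∧ x.2 ≠ y.2) :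
    G.IsSolution S := by
  refine ⟨hc, fun x hx y hy hxy => ?_⟩
  obtain ⟨h1, h2⟩ := hS x hx y hy hxy
  exact ⟨fun h => h1 (by rw [h]), h2, internallyDisjoint_of_snd_ne hT hst h1⟩

/-- The edge of the bipartite graph that belongs to a colored path. -/
def matchingEdge (hst : s ≠ t) (x : G.graph.Path s t × C) : Sym2 (G.graph.neighborSet s ⊕ C) :=
  s(.inl ⟨(x.1 : G.graph.Walk s t).snd, adj_snd hst x.1⟩, .inr x.2)

theorem mk_eq_matchingEdge (hst : s ≠ t) (x : G.graph.Path s t × C)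
    (v : G.graph.neighborSet s) (c : C) :
    s(.inl v, .inr c) = matchingEdge hst x ↔ (x.1 : G.graph.Walk s t).snd = v ∧ x.2 = c := by
  simp [matchingEdge, Subtype.ext_iff, eq_comm]

/-- Every edge of the bipartite graph joins a neighbour to a color, so `Corresponds` determines the
whole edge set as the image of `S` under `matchingEdge`. This map is injective on `S` because second
vertices are distinct. -/
theorem Corresponds.ncard_edgeSet (hst : s ≠ t) {S : Finset (G.graph.Path s t × C)}
    (hS : G.IsSolution S) {M : (G.matchingGraph s t).Subgraph} (h : G.Corresponds S M) :
    M.edgeSet.ncard = S.card := by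
  have key : ∀ v c, s(Sum.inl v, Sum.inr c) ∈ M.edgeSet ↔
      s(Sum.inl v, Sum.inr c) ∈ matchingEdge hst '' (S : Set (G.graph.Path s t × C)) := by
    intro v c
    rw [SimpleGraph.Subgraph.mem_edgeSet, h v c]
    constructor
    · rintro ⟨p, hp, hv⟩
      exact ⟨(p, c), hp, ((mk_eq_matchingEdge hst _ v c).2 ⟨hv, rfl⟩).symm⟩
    · rintro ⟨⟨p, d⟩, hp, hv⟩
      obtain ⟨h1, rfl⟩ := (mk_eq_matchingEdge hst _ v c).1 hv.symm
      exact ⟨p, hp, h1⟩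
  have himage : M.edgeSet = matchingEdge hst '' (S : Set (G.graph.Path s t × C)) := by
    ext e
    induction e with
    | _ a b =>
    rcases a with v | c <;> rcases b with w | d
    · refine iff_of_false (fun hm => (M.adj_sub hm : False)) ?_
      rintro ⟨x, -, hx⟩
      simp [matchingEdge] at hx
    · exact key v d
    · rw [Sym2.eq_swap]
      exact key w c
    · refine iff_of_false (fun hm => (M.adj_sub hm : False)) ?_
      rintro ⟨x, -, hx⟩
      simp [matchingEdge] at hx
  rw [himage, Set.InjOn.ncard_image, Set.ncard_coe_finset]
  intro x hx y hy hxy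
  by_contra hne
  exact hS.snd_ne hst hx hy hne ((mk_eq_matchingEdge hst y _ _).1 hxy).1.symm

/-- A solution gives a matching. -/
theorem IsSolution.exists_matching (hst : s ≠ t) {S : Finset (G.graph.Path s t × C)}
    (hS : G.IsSolution S) : ∃ M : (G.matchingGraph s t).Subgraph,
      M.IsMatching ∧ G.Corresponds S M ∧ M.edgeSet.ncard = S.card := by
  have adj : ∀ (a b : G.graph.neighborSet s ⊕ C) (x : G.graph.Path s t × C), x ∈ S →
      s(a, b) = matchingEdge hst x → (G.matchingGraph s t).Adj a b := by
    rintro (v | c) (w | d) x hx h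
    · simp [matchingEdge] at h
    · obtain ⟨h1, rfl⟩ := (mk_eq_matchingEdge hst x v d).1 h
      exact ⟨x.1, hS.1 x hx, h1⟩
    · rw [Sym2.eq_swap] at h
      obtain ⟨h1, rfl⟩ := (mk_eq_matchingEdge hst x w c).1 h
      exact ⟨x.1, hS.1 x hx, h1⟩
    · simp [matchingEdge] at h
  let M : (G.matchingGraph s t).Subgraph :=
    -- Only covered vertices belong to `M`, since a matching must meet every vertex of the subgraph.
    { verts := {a | ∃ b, ∃ x ∈ S, s(a, b) = matchingEdge hst x}
      Adj := fun a b => ∃ x ∈ S, s(a, b) = matchingEdge hst x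
      adj_sub := fun ⟨x, hx, h⟩ => adj _ _ x hx h
      edge_vert := fun h => ⟨_, h⟩
      symm := ⟨fun a b h => by simpa only [Sym2.eq_swap] using h⟩ }
  have hM : G.Corresponds S M := by
    intro v c
    constructor
    · rintro ⟨⟨p, d⟩, hx, h⟩
      obtain ⟨h1, rfl⟩ := (mk_eq_matchingEdge hst _ v c).1 h
      exact ⟨p, hx, h1⟩
    · rintro ⟨p, hp, h⟩
      exact ⟨(p, c), hp, (mk_eq_matchingEdge hst _ v c).2 ⟨h, rfl⟩⟩
  refine ⟨M, ?_, hM, hM.ncard_edgeSet hst hS⟩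
  rintro a ⟨b, x, hx, h⟩
  refine ⟨b, ⟨x, hx, h⟩, ?_⟩
  rintro b' ⟨y, hy, h'⟩
  by_cases hxy : x = y
  · subst hxy
    exact Sym2.congr_right.1 (h'.trans h.symm)
  · exfalso
    have h1 := hS.snd_ne hst hx hy hxy
    have h2 := (hS.2 x hx y hy hxy).2.1
    have ha : a ∈ matchingEdge hst x := h ▸ Sym2.mem_mk_left a b
    have ha' : a ∈ matchingEdge hst y := h' ▸ Sym2.mem_mk_left a b'
    simp only [matchingEdge, Sym2.mem_iff] at ha ha'
    rcases ha with rfl | rfl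
    · simp only [Sum.inl.injEq, reduceCtorEq, or_false] at ha'
      exact h1 (congrArg Subtype.val ha')
    · simp only [Sum.inr.injEq, reduceCtorEq, false_or] at ha'
      exact h2 ha'

/-- If the graph without the target is a tree, then a matching gives a solution. -/
theorem exists_solution_of_isMatching [Finite V] [Finite C] (hT : (G.deleteTarget t).IsTree)
    (hst : s ≠ t) {M : (G.matchingGraph s t).Subgraph} (hM : M.IsMatching) :
    ∃ S : Finset (G.graph.Path s t × C),
      G.IsSolution S ∧ G.Corresponds S M ∧ S.card = M.edgeSet.ncard := by
  classical
  -- One path is chosen for each edge of `M`; the tree makes every choice disjoint.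
  have hP : ∀ e : {e : G.graph.neighborSet s × C // M.Adj (.inl e.1) (.inr e.2)},
      ∃ p : G.graph.Path s t, G.Colored p e.1.2 ∧ (p : G.graph.Walk s t).snd = e.1.1 :=
    fun e => M.adj_sub e.2
  choose P hP1 hP2 using hP
  have hfin : (Set.range fun e => (P e, e.1.2)).Finite := Set.finite_range _
  have hS : G.IsSolution hfin.toFinset := by
    refine isSolution_of_snd_ne hT hst ?_ ?_
    · intro x hx
      obtain ⟨e, rfl⟩ := hfin.mem_toFinset.1 hx
      exact hP1 e
    · intro x hx y hy hxy
      obtain ⟨⟨⟨v, c⟩, h⟩, rfl⟩ := hfin.mem_toFinset.1 hx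
      obtain ⟨⟨⟨w, d⟩, h'⟩, rfl⟩ := hfin.mem_toFinset.1 hy
      simp only [hP2]
      constructor
      · intro hvw
        obtain rfl : v = w := Subtype.ext hvw
        obtain rfl : c = d := Sum.inr_injective (hM.eq_of_adj_left h h')
        exact hxy rfl
      · rintro rfl
        obtain rfl : v = w := Sum.inl_injective (hM.eq_of_adj_right h h')
        exact hxy rfl
  have hc : G.Corresponds hfin.toFinset M := by
    intro v c
    constructor
    · exact fun h => ⟨P ⟨(v, c), h⟩, hfin.mem_toFinset.2 ⟨⟨(v, c), h⟩, rfl⟩, hP2 _⟩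
    · rintro ⟨p, hp, hv⟩
      obtain ⟨⟨⟨w, d⟩, h⟩, he⟩ := hfin.mem_toFinset.1 hp
      obtain ⟨rfl, rfl⟩ := Prod.ext_iff.1 he
      obtain rfl : w = v := Subtype.ext ((hP2 _).symm.trans hv)
      exact h
  exact ⟨_, hS, hc, (hc.ncard_edgeSet hst hS).symm⟩

theorem isOptimum_iff_isGreatest_matching [Finite V] [Finite C] (hT : (G.deleteTarget t).IsTree)
    (hst : s ≠ t) (h : ℕ) : G.IsOptimum s t h ↔
      IsGreatest {k | ∃ M : (G.matchingGraph s t).Subgraph,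
        M.IsMatching ∧ M.edgeSet.ncard = k} h := by
  have : {k | ∃ S : Finset (G.graph.Path s t × C), G.IsSolution S ∧ S.card = k} =
      {k | ∃ M : (G.matchingGraph s t).Subgraph, M.IsMatching ∧ M.edgeSet.ncard = k} := by
    ext k
    constructor
    · rintro ⟨S, hS, rfl⟩
      obtain ⟨M, hM, -, h⟩ := hS.exists_matching hst
      exact ⟨M, hM, h⟩
    · rintro ⟨M, hM, rfl⟩
      obtain ⟨S, hS, -, h⟩ := exists_solution_of_isMatching hT hst hM
      exact ⟨S, hS, h⟩
  rw [IsOptimum, this]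

end EdgeColoredGraph

/-! ### Colored routes to the target -/

namespace MaxCDDP

open RAM

/-- The word `I` of length `N` encodes a graph with `n` vertices and `q` colors, source `s` and
target `t`, in which `E x y c` tells whether there is an edge from `x` to `y` with color `c`. -/
structure IsInput (I : ℕ → ℕ) (N n q s t : ℕ) (E : ℕ → ℕ → ℕ → Prop) : Prop where
  inp_zero : I 0 = n
  inp_one : I 1 = q
  inp_two : I 2 = s
  inp_three : I 3 = t
  -- By these two bounds the cut-offs at `N` never take effect for factors and loop bounds up to `n`
  -- or `q + 1`.
  le_len : n ≤ N
  lt_len : q < N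
  source_lt : s < n
  target_lt : t < n
  source_ne_target : s ≠ t
  -- After four header entries come blocks of `q + 1` bits, each led by the adjacency bit; hence the
  -- offset `5`.
  edge : ∀ x < n, ∀ y < n, ∀ c < q, I (5 + c + (x * n + y) * (q + 1)) ≠ 0 ↔ E x y c

/-- The number of vertices. -/
abbrev vertexCount : Expr := .inp (.const 0)

/-- The number of colors. -/
abbrev colorCount : Expr := .inp (.const 1)

/-- The source. -/
abbrev source : Expr := .inp (.const 2)

/-- The target. -/
abbrev target : Expr := .inp (.const 3)

/-- The bit that tells whether there is an edge from `x` to `y` with color `c`. -/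
abbrev edgeBit (x y c : Expr) : Expr :=
  .inp (.add (.add (.const 5) c)
    (.mul (.add (.mul x vertexCount) y) (.add colorCount (.const 1))))

/-- The address of the pair of a color `c` and a vertex `x`. -/
abbrev address (c x : Expr) : Expr := .add (.mul c vertexCount) x

section IsInput

variable {I : ℕ → ℕ} {N n q s t : ℕ} {E : ℕ → ℕ → ℕ → Prop} (hI : IsInput I N n q s t E)
include hI

theorem IsInput.eval_vertexCount (σ : State) : vertexCount.eval I N σ = n := hI.inp_zero

theorem IsInput.eval_colorCount (σ : State) : colorCount.eval I N σ = q := hI.inp_one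

theorem IsInput.eval_source (σ : State) : source.eval I N σ = s := hI.inp_two

theorem IsInput.eval_target (σ : State) : target.eval I N σ = t := hI.inp_three

theorem IsInput.eval_address (σ : State) (c x : Expr) :
    (address c x).eval I N σ = c.eval I N σ * n + x.eval I N σ := by
  simp only [Expr.eval, hI.inp_zero, min_eq_left hI.le_len]

end IsInput

theorem address_inj {n c d x y : ℕ} (hx : x < n) (hy : y < n) :
    c * n + x = d * n + y ↔ c = d ∧ x = y := by
  refine ⟨fun h => ?_, fun ⟨h1, h2⟩ => by rw [h1, h2]⟩
  have h1 : (c * n + x) / n = c := by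
    rw [mul_comm, Nat.mul_add_div (by omega), Nat.div_eq_of_lt hx, add_zero]
  have h2 : (d * n + y) / n = d := by
    rw [mul_comm, Nat.mul_add_div (by omega), Nat.div_eq_of_lt hy, add_zero]
  obtain rfl : c = d := by rw [← h1, h, h2]
  exact ⟨rfl, by omega⟩

/-! ### Routes and pointer tables -/

/-- Following the pointers `g` from `x` one reaches `t` along the vertices `l`, by edges of color
`c` and avoiding `s`. -/
inductive Route (E : ℕ → ℕ → ℕ → Prop) (n s t c : ℕ) (g : ℕ → ℕ) : ℕ → List ℕ → Prop
  | nil : Route E n s t c g t [t]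
  -- Pointers are shifted by one, and `0` means that there is none.
  | cons {x y l} : x ≠ s → x ≠ t → x < n → y < n → g x = y + 1 → E x y c → x ∉ l →
      Route E n s t c g y l → Route E n s t c g x (x :: l)

/-- From `x` one reaches `t` in at most `k` steps by edges of color `c` that do not start in `s`. -/
inductive Reach (E : ℕ → ℕ → ℕ → Prop) (n s t c : ℕ) : ℕ → ℕ → Prop
  | nil (k) : Reach E n s t c k t
  | cons {k x y} : x ≠ s → x < n → y < n → E x y c → Reach E n s t c k y →
      Reach E n s t c (k + 1) x

section

variable {E : ℕ → ℕ → ℕ → Prop} {n s t c : ℕ} {g g' : ℕ → ℕ}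

theorem Reach.mono {k x : ℕ} (h : Reach E n s t c k x) : ∀ {m : ℕ}, k ≤ m →
    Reach E n s t c m x := by
  induction h with
  | nil k => exact fun _ => .nil _
  | cons h1 h2 h3 h4 _ ih =>
    intro m hm
    obtain ⟨m, rfl⟩ : ∃ m', m = m' + 1 := ⟨m - 1, by omega⟩
    exact .cons h1 h2 h3 h4 (ih (by omega))

/-- A vertex without a pointer is therefore on no route, and can be put in front of one without
repetition. -/
theorem Route.pointer_ne_zero {x : ℕ} {l : List ℕ} (h : Route E n s t c g x l) (ht : g t ≠ 0) :
    ∀ y ∈ l, g y ≠ 0 := by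
  induction h with
  | nil => simpa using ht
  | cons h1 h2 h3 h4 h5 h6 h7 _ ih =>
    intro y hy
    rcases List.mem_cons.1 hy with rfl | hy
    · omega
    · exact ih y hy

theorem Route.congr {x : ℕ} {l : List ℕ} (h : Route E n s t c g x l)
    (hg : ∀ x < n, g x ≠ 0 → g' x = g x) : Route E n s t c g' x l := by
  induction h with
  | nil => exact .nil
  | cons h1 h2 h3 h4 h5 h6 h7 _ ih =>
    exact .cons h1 h2 h3 h4 ((hg _ h3 (by omega)).trans h5) h6 h7 ih

theorem Route.nodup {x : ℕ} {l : List ℕ} (h : Route E n s t c g x l) : l.Nodup := by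
  induction h with
  | nil => simp
  | cons _ _ _ _ _ _ h _ ih => exact List.nodup_cons.2 ⟨h, ih⟩

theorem Route.lt {x : ℕ} {l : List ℕ} (h : Route E n s t c g x l) (ht : t < n) :
    ∀ y ∈ l, y < n := by
  induction h with
  | nil => simpa using ht
  | cons _ _ h _ _ _ _ _ ih => exact List.forall_mem_cons.2 ⟨h, ih⟩

theorem Route.length_le {x : ℕ} {l : List ℕ} (h : Route E n s t c g x l) (ht : t < n) :
    l.length ≤ n := by
  have := (h.nodup.subperm fun y hy => List.mem_range.2 (h.lt ht y hy)).length_le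
  simpa using this

end

/-- The pointers in the array `A`, where the pointer for the color `c` and the vertex `x` is in the
cell `c * n + x`, lead to `t`. -/
structure IsPointerTable (E : ℕ → ℕ → ℕ → Prop) (n q s t : ℕ) (A : ℕ → ℕ) : Prop where
  target : ∀ c < q, A (c * n + t) ≠ 0
  route : ∀ c < q, ∀ x < n, A (c * n + x) ≠ 0 →
    ∃ l, Route E n s t c (fun y => A (c * n + y)) x l

/-- The nonzero entries of `A` are kept in `A'`. -/
def Extends (A A' : ℕ → ℕ) : Prop := ∀ i, A i ≠ 0 → A' i = A i

theorem Extends.refl (A : ℕ → ℕ) : Extends A A := fun _ _ => rfl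

theorem Extends.trans {A A' A'' : ℕ → ℕ} (h : Extends A A') (h' : Extends A' A'') :
    Extends A A'' := fun i hi => (h' i (by rwa [h i hi])).trans (h i hi)

theorem Extends.ne_zero {A A' : ℕ → ℕ} (h : Extends A A') {i : ℕ} (hi : A i ≠ 0) : A' i ≠ 0 := by
  rwa [h i hi]

theorem extends_update {A : ℕ → ℕ} {i w : ℕ} (hi : A i = 0) : Extends A (Function.update A i w) := by
  intro j hj
  rw [Function.update_of_ne]
  rintro rfl
  exact hj hi

/-- The route of `y` avoids `x`, which had no pointer, so it can be prolonged to `x`. Existing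
routes use only nonzero pointers, and these are unchanged. -/
theorem IsPointerTable.update {E : ℕ → ℕ → ℕ → Prop} {n q s t : ℕ} {A : ℕ → ℕ}
    (h : IsPointerTable E n q s t A) {c x y : ℕ} (hc : c < q) (hx : x < n) (hy : y < n)
    (hxs : x ≠ s) (hA : A (c * n + x) = 0) (hA' : A (c * n + y) ≠ 0) (hE : E x y c) :
    IsPointerTable E n q s t (Function.update A (c * n + x) (y + 1)) := by
  have hext := extends_update (w := y + 1) hA
  refine ⟨fun d hd => hext.ne_zero (h.target d hd), fun d hd z hz hdz => ?_⟩
  by_cases hzx : c * n + x = d * n + z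
  · obtain ⟨rfl, rfl⟩ := (address_inj hx hz).1 hzx
    obtain ⟨l, hl⟩ := h.route c hc y hy hA'
    refine ⟨x :: l, .cons hxs ?_ hx hy (by simp) hE (fun hxl => ?_)
      (hl.congr fun u _ hu => hext _ hu)⟩
    · rintro rfl
      exact h.target c hc hA
    · exact hl.pointer_ne_zero (h.target c hc) x hxl hA
  · rw [Function.update_of_ne (Ne.symm hzx)] at hdz
    obtain ⟨l, hl⟩ := h.route d hd z hz hdz
    exact ⟨l, hl.congr fun u _ hu => hext _ hu⟩

/-- The rule for loops that treat every index: round `k` establishes `Q k`, which persists because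
later rounds move upwards in the preorder `R`. `J` is the invariant. -/
theorem iterate_forall {x : ℕ} {f : State → State} {σ : State} {m : ℕ}
    (J : State → Prop) (R : State → State → Prop) (Q : ℕ → State → Prop)
    (refl : ∀ τ, R τ τ) (trans : ∀ τ υ φ, R τ υ → R υ φ → R τ φ)
    (mono : ∀ k τ υ, R τ υ → Q k τ → Q k υ) (zero : J σ)
    (step : ∀ k < m, ∀ τ, J τ → R τ (f (τ.setVar x k)) ∧ J (f (τ.setVar x k)) ∧
      Q k (f (τ.setVar x k))) :
    R σ (iterate x f σ m) ∧ J (iterate x f σ m) ∧ ∀ k < m, Q k (iterate x f σ m) := by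
  refine iterate_induction (fun m τ => R σ τ ∧ J τ ∧ ∀ k < m, Q k τ)
    ⟨refl σ, zero, by simp⟩ fun k hk τ ⟨h1, h2, h3⟩ => ?_
  obtain ⟨g1, g2, g3⟩ := step k hk τ h2
  refine ⟨trans _ _ _ h1 g1, g2, fun j hj => ?_⟩
  rcases Nat.lt_succ_iff_lt_or_eq.1 hj with hj | rfl
  · exact mono _ _ _ g1 (h3 j hj)
  · exact g3

/-! ### The relaxation passes -/

/-- Follow the edge from the vertex in variable `2` to the vertex in variable `3`, in the color in
variable `1`, if this gives the former vertex its first pointer. -/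
def relaxEdge : Stmt :=
  -- With truncated subtraction, `(a - b) + (b - a)` is nonzero iff `a ≠ b`.
  .ite (.add (.sub (.var 2) source) (.sub source (.var 2)))
    (.ite (.arr 1 (address (.var 1) (.var 2))) .skip
      (.ite (.arr 1 (address (.var 1) (.var 3)))
        (.ite (edgeBit (.var 2) (.var 3) (.var 1))
          (.store 1 (address (.var 1) (.var 2)) (.add (.var 3) (.const 1))) .skip) .skip)) .skip

/-- Follow all edges once. -/
def relaxAll : Stmt :=
  .rep 1 colorCount (.rep 2 vertexCount (.rep 3 vertexCount relaxEdge))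

/-- Compute the pointer table in array `1`. -/
def findRoutes : Stmt :=
  .seq (.rep 1 colorCount (.store 1 (address (.var 1) target) (.add target (.const 1))))
    (.rep 4 vertexCount relaxAll)

section

variable {I : ℕ → ℕ} {N n q s t : ℕ} {E : ℕ → ℕ → ℕ → Prop} (hI : IsInput I N n q s t E)
include hI

theorem relaxEdge_spec {c x y : ℕ} (hc : c < q) (hx : x < n) (hy : y < n) {σ : State}
    (h1 : σ.var 1 = c) (h2 : σ.var 2 = x) (h3 : σ.var 3 = y)
    (hσ : IsPointerTable E n q s t (σ.arr 1)) :
    Extends (σ.arr 1) ((relaxEdge.eval I N σ).arr 1) ∧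
      IsPointerTable E n q s t ((relaxEdge.eval I N σ).arr 1) ∧
      (x ≠ s → σ.arr 1 (c * n + y) ≠ 0 → E x y c →
        (relaxEdge.eval I N σ).arr 1 (c * n + x) ≠ 0) := by
  have e1 := hI.edge x hx y hy c hc
  simp only [relaxEdge, Stmt.eval]
  split_ifs with a0 a1 a2 a3 <;>
    simp only [Expr.eval, h1, h2, h3, hI.inp_zero, hI.inp_one, hI.inp_two,
      min_eq_left hI.le_len, min_eq_left (show q + 1 ≤ N from hI.lt_len), e1] at *
  · exact ⟨.refl _, hσ, fun _ _ _ => a1⟩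
  · simp only [State.setArr_arr, if_true]
    exact ⟨extends_update (by omega), hσ.update hc hx hy (by omega) (by omega) a2 a3, by simp⟩
  · exact ⟨.refl _, hσ, fun _ _ h => absurd h a3⟩
  · exact ⟨.refl _, hσ, fun _ h => absurd h a2⟩
  · exact ⟨.refl _, hσ, fun h => absurd h (by omega)⟩

/-- Pointers are never removed, so an edge into a vertex that had a pointer before the pass is still
usable when its turn comes. The three nested loops keep `Extends A` for this purpose. -/
theorem relaxAll_spec {σ : State} (hσ : IsPointerTable E n q s t (σ.arr 1)) :
    Extends (σ.arr 1) ((relaxAll.eval I N σ).arr 1) ∧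
      IsPointerTable E n q s t ((relaxAll.eval I N σ).arr 1) ∧
      ∀ c < q, ∀ x < n, ∀ y < n, x ≠ s → σ.arr 1 (c * n + y) ≠ 0 → E x y c →
        (relaxAll.eval I N σ).arr 1 (c * n + x) ≠ 0 := by
  set A := σ.arr 1
  let R : State → State → Prop := fun τ υ => Extends (τ.arr 1) (υ.arr 1)
  let T : State → Prop := fun τ => IsPointerTable E n q s t (τ.arr 1) ∧ Extends A (τ.arr 1)
  let Q : ℕ → ℕ → ℕ → State → Prop := fun c x y τ =>
    x ≠ s → A (c * n + y) ≠ 0 → E x y c → τ.arr 1 (c * n + x) ≠ 0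
  have hQ : ∀ c x y τ υ, R τ υ → Q c x y τ → Q c x y υ := fun c x y τ υ h hq a1 a2 a3 =>
    h.ne_zero (hq a1 a2 a3)
  have hR : ∀ τ, R τ τ := fun τ => .refl _
  have hR' : ∀ τ υ φ, R τ υ → R υ φ → R τ φ := fun _ _ _ h h' => h.trans h'
  have hm : min (vertexCount.eval I N σ) N = n := by
    rw [hI.eval_vertexCount, min_eq_left hI.le_len]
  obtain ⟨h1, h2, h3⟩ := iterate_forall (x := 1) (σ := σ) (m := q)
    (f := (Stmt.rep 2 vertexCount (.rep 3 vertexCount relaxEdge)).eval I N) T R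
    (fun c τ => ∀ x < n, ∀ y < n, Q c x y τ) hR hR'
    (fun c τ υ h hq x hx y hy => hQ _ _ _ _ _ h (hq x hx y hy)) ⟨hσ, .refl _⟩ (by
      intro c hc τ hτ
      have := iterate_forall (x := 2) (σ := τ.setVar 1 c) (m := n)
        (f := (Stmt.rep 3 vertexCount relaxEdge).eval I N) (fun τ => T τ ∧ τ.var 1 = c) R
        (fun x τ => ∀ y < n, Q c x y τ) hR hR'
        (fun x τ υ h hq y hy => hQ _ _ _ _ _ h (hq y hy)) ⟨hτ, by simp⟩ (by
          rintro x hx τ ⟨hτ, hc1⟩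
          have := iterate_forall (x := 3) (σ := τ.setVar 2 x) (m := n)
            (f := relaxEdge.eval I N) (fun τ => T τ ∧ τ.var 1 = c ∧ τ.var 2 = x) R
            (fun y τ => Q c x y τ) hR hR'
            (fun y τ υ h hq => hQ _ _ _ _ _ h hq) ⟨hτ, by simp [hc1], by simp⟩ (by
              rintro y hy τ ⟨hτ, hc1, hc2⟩
              obtain ⟨g1, g2, g3⟩ := relaxEdge_spec hI hc hx hy (σ := τ.setVar 3 y)
                (by simp [hc1]) (by simp [hc2]) (by simp) hτ.1
              refine ⟨g1, ⟨⟨g2, hτ.2.trans g1⟩, ?_, ?_⟩, fun a1 a2 a3 =>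
                g3 a1 (hτ.2.ne_zero a2) a3⟩
              · rw [Stmt.eval_var _ (by rfl)]
                simp [hc1]
              · rw [Stmt.eval_var _ (by rfl)]
                simp [hc2])
          rw [Stmt.eval, hI.eval_vertexCount, min_eq_left hI.le_len]
          exact ⟨this.1, ⟨this.2.1.1, this.2.1.2.1⟩, this.2.2⟩)
      rw [Stmt.eval, hI.eval_vertexCount, min_eq_left hI.le_len]
      exact ⟨this.1, this.2.1.1, this.2.2⟩)
  rw [relaxAll, Stmt.eval, hI.eval_colorCount, min_eq_left hI.lt_len.le]
  exact ⟨h1, h2.1, h3⟩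

/-- After `k` passes every vertex at most `k` steps from `t` has a pointer. Initially only `t` has
one, to itself; it marks `t` as reached and is never followed. -/
theorem findRoutes_spec {σ : State} (hσ : σ.arr 1 = fun _ => 0) :
    IsPointerTable E n q s t ((findRoutes.eval I N σ).arr 1) ∧
      ∀ c < q, ∀ x, Reach E n s t c n x → (findRoutes.eval I N σ).arr 1 (c * n + x) ≠ 0 := by
  rw [findRoutes, Stmt.eval, Stmt.eval, Stmt.eval, hI.eval_colorCount, hI.eval_vertexCount,
    min_eq_left hI.lt_len.le, min_eq_left hI.le_len]
  refine iterate_induction (fun k τ => IsPointerTable E n q s t (τ.arr 1) ∧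
      ∀ c < q, ∀ x, Reach E n s t c k x → τ.arr 1 (c * n + x) ≠ 0) ?_ ?_
  · have := iterate_induction (x := 1) (σ := σ) (m := q)
      (f := (Stmt.store 1 (address (.var 1) target) (.add target (.const 1))).eval I N)
      (fun k τ => ∀ c, ∀ x < n, τ.arr 1 (c * n + x) ≠ 0 ↔ c < k ∧ x = t)
      (by simp [hσ]) (by
        intro k hk τ hτ c x hx
        rw [Stmt.eval, hI.eval_address, Expr.eval, Expr.eval.eq_5, Expr.eval.eq_1,
          hI.eval_target, State.setArr_arr, if_pos rfl, Function.update_apply]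
        simp only [State.setVar_var, if_true, address_inj hx hI.target_lt, State.setVar_arr]
        split_ifs with h
        · omega
        · rw [hτ c x hx]
          omega)
    refine ⟨⟨fun c hc => (this c t hI.target_lt).2 ⟨hc, rfl⟩, fun c hc x hx hcx => ?_⟩,
      fun c hc x hx => ?_⟩
    · obtain rfl := ((this c x hx).1 hcx).2
      exact ⟨_, .nil⟩
    · cases hx
      exact (this c t hI.target_lt).2 ⟨hc, rfl⟩
  · rintro k hk τ ⟨h1, h2⟩
    obtain ⟨g1, g2, g3⟩ := relaxAll_spec hI (σ := τ.setVar 4 k) h1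
    refine ⟨g2, fun c hc x hx => ?_⟩
    cases hx with
    | nil => exact g2.target c hc
    | cons a1 a2 a3 a4 a5 => exact g3 c hc x a2 _ a3 a1 (h2 c hc _ a5) a4

end

end MaxCDDP

/-! ### Bipartite matching by auction -/

namespace MaxCDDP

open RAM

/-- The state of an auction in which the vertices below `n` bid for the colors below `q` that are
adjacent to them: `price c` is the price of the color `c`, `mate (v + 1) = c + 1` tells that the
vertex `v` holds the color `c`, and so does `owner c = v + 1`. -/
structure IsAuction (Adj : ℕ → ℕ → Prop) (n q : ℕ) (price mate owner : ℕ → ℕ) : Prop where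
  owner_iff : ∀ v c, owner c = v + 1 ↔ mate (v + 1) = c + 1
  vertex_lt : ∀ v c, mate (v + 1) = c + 1 → v < n
  color_lt : ∀ v c, mate (v + 1) = c + 1 → c < q
  adj : ∀ v c, mate (v + 1) = c + 1 → Adj v c
  -- A color is cheapest among the adjacent ones when taken, then rises by one; afterwards the other
  -- prices can only grow.
  greedy : ∀ v c, mate (v + 1) = c + 1 → ∀ d < q, Adj v d → price c ≤ price d + 1
  owned : ∀ c < q, price c ≠ 0 → owner c ≠ 0
  le : ∀ c < q, price c ≤ q + 1

/-- The vertex `v` holds a color, or all colors adjacent to it are too expensive. -/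
def Settled (Adj : ℕ → ℕ → Prop) (q : ℕ) (price mate : ℕ → ℕ) (v : ℕ) : Prop :=
  mate (v + 1) = 0 → ∀ c < q, Adj v c → q + 1 ≤ price c

section

variable {Adj : ℕ → ℕ → Prop} {n q : ℕ} {price mate owner : ℕ → ℕ}

/-- The total price is the potential that bounds the number of bids. -/
theorem IsAuction.sum_le (h : IsAuction Adj n q price mate owner) :
    ∑ c ∈ Finset.range q, price c ≤ q * (q + 1) := by
  simpa using Finset.sum_le_card_nsmul (Finset.range q) price (q + 1)
    fun c hc => h.le c (Finset.mem_range.1 hc)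

/-- A vertex takes a cheapest color from its owner. -/
theorem IsAuction.bid (h : IsAuction Adj n q price mate owner) {v c : ℕ} (hv : v < n) (hc : c < q)
    (hm : mate (v + 1) = 0) (hvc : Adj v c) (hp : price c < q + 1)
    (hmin : ∀ d < q, Adj v d → price c ≤ price d) :
    IsAuction Adj n q (Function.update price c (price c + 1))
      (Function.update (Function.update mate (owner c) 0) (v + 1) (c + 1))
      (Function.update owner c (v + 1)) := by
  -- The previous owner loses `c`. If there is none, `owner c = 0` and the reset falls on the cell
  -- `0`, which belongs to no vertex.
  have key : ∀ w d, Function.update (Function.update mate (owner c) 0) (v + 1) (c + 1) (w + 1) =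
      d + 1 ↔ w = v ∧ d = c ∨ w ≠ v ∧ d ≠ c ∧ mate (w + 1) = d + 1 := by
    intro w d
    have h1 := h.owner_iff w c
    simp only [Function.update_apply]
    split_ifs with h2 h3 <;> grind
  have hle : ∀ d, price d ≤ Function.update price c (price c + 1) d := by
    intro d
    rw [Function.update_apply]
    split_ifs with hd
    · rw [hd]
      omega
    · exact le_rfl
  constructor
  · intro w d
    rw [key, Function.update_apply]
    have h1 := h.owner_iff w d
    split_ifs <;> grind
  · intro w d hw
    rcases (key w d).1 hw with ⟨rfl, -⟩ | ⟨-, -, hw⟩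
    · exact hv
    · exact h.vertex_lt w d hw
  · intro w d hw
    rcases (key w d).1 hw with ⟨-, rfl⟩ | ⟨-, -, hw⟩
    · exact hc
    · exact h.color_lt w d hw
  · intro w d hw
    rcases (key w d).1 hw with ⟨rfl, rfl⟩ | ⟨-, -, hw⟩
    · exact hvc
    · exact h.adj w d hw
  · intro w d hw e he hwe
    refine le_trans ?_ (Nat.add_le_add_right (hle e) 1)
    rcases (key w d).1 hw with ⟨rfl, rfl⟩ | ⟨-, hd, hw⟩
    · simpa using hmin e he hwe
    · rw [Function.update_of_ne hd]
      exact h.greedy w d hw e he hwe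
  · intro d hd
    simp only [Function.update_apply]
    split_ifs
    · simp
    · exact h.owned d hd
  · intro d hd
    rw [Function.update_apply]
    split_ifs
    · omega
    · exact h.le d hd

/-- When all vertices are settled, the colors are held in a maximum matching. -/
theorem IsAuction.card_le (h : IsAuction Adj n q price mate owner)
    (hs : ∀ v < n, Settled Adj q price mate v) (F : Finset (ℕ × ℕ))
    (hF : ∀ x ∈ F, x.1 < n ∧ x.2 < q ∧ Adj x.1 x.2)
    (hF1 : ∀ x ∈ F, ∀ y ∈ F, x.1 = y.1 → x = y) (hF2 : ∀ x ∈ F, ∀ y ∈ F, x.2 = y.2 → x = y) :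
    F.card ≤ ((Finset.range n).filter fun v => mate (v + 1) ≠ 0).card := by
  -- The `q` prices cannot fill the `q + 1` values `1, …, q + 1`.
  obtain ⟨j, hj, hj'⟩ : ∃ j ∈ Finset.Icc 1 (q + 1), j ∉ (Finset.range q).image price := by
    by_contra! hcon
    have h1 := Finset.card_le_card (show Finset.Icc 1 (q + 1) ⊆ _ from hcon)
    have h2 := Finset.card_image_le (s := Finset.range q) (f := price)
    simp only [Nat.card_Icc, Finset.card_range] at h1 h2
    omega
  rw [Finset.mem_Icc] at hj
  have hne : ∀ c < q, price c ≠ j := fun c hc hcj =>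
    hj' (Finset.mem_image.2 ⟨c, Finset.mem_range.2 hc, hcj⟩)
  have hown : ∀ c < q, j < price c → mate (owner c - 1 + 1) = c + 1 := by
    intro c hc hjc
    have := h.owned c hc (by omega)
    exact (h.owner_iff _ c).1 (by omega)
  -- By `greedy`, the owner of a color dearer than `j` is adjacent only to colors of price at least
  -- `j`, hence above `j`, as `j` is not a price.
  have hcross : ∀ x ∈ F, ∀ y ∈ F, j < price x.2 → ¬ j < price y.2 → owner x.2 - 1 ≠ y.1 := by
    intro x hx y hy hjx hjy he
    have h1 := hown _ (hF x hx).2.1 hjx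
    rw [he] at h1
    have := h.greedy _ _ h1 _ (hF y hy).2.1 (hF y hy).2.2
    have := hne _ (hF y hy).2.1
    omega
  refine Finset.card_le_card_of_injOn (fun x => if j < price x.2 then owner x.2 - 1 else x.1) ?_ ?_
  · intro x hx
    obtain ⟨h1, h2, h3⟩ := hF x hx
    simp only [Finset.coe_filter, Finset.mem_range, Set.mem_ofPred_eq]
    split_ifs with hjx
    · have := hown _ h2 hjx
      exact ⟨h.vertex_lt _ _ this, by omega⟩
    -- An unmatched settled vertex would make the price at least `q + 1 ≥ j`, hence above `j`.
    · refine ⟨h1, fun h0 => ?_⟩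
      have := hs _ h1 h0 _ h2 h3
      have := hne _ h2
      omega
  · intro x hx y hy hxy
    dsimp only at hxy
    split_ifs at hxy with h1 h2 h2
    · have g1 := hown _ (hF x hx).2.1 h1
      have g2 := hown _ (hF y hy).2.1 h2
      rw [hxy] at g1
      exact hF2 x hx y hy (by omega)
    · exact absurd hxy (hcross x hx y hy h1 h2)
    · exact absurd hxy.symm (hcross y hy x hx h2 h1)
    · exact hF1 x hx y hy hxy

end

/-! ### The auction as a program -/

/-- Find a cheapest color that is adjacent to the vertex in variable `7`, and store its successor in
variable `9`, or `0` if all of them are too expensive. -/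
def cheapestColor : Stmt :=
  -- Variable `10` is the price to beat; starting at `q + 1`, it excludes the colors that are too
  -- expensive.
  .seq (.set 9 (.const 0)) (.seq (.set 10 (.add colorCount (.const 1)))
    (.rep 8 colorCount
      (.ite (edgeBit source (.var 7) (.var 8))
        (.ite (.arr 1 (address (.var 8) (.var 7)))
          (.ite (.sub (.var 10) (.arr 2 (.var 8)))
            (.seq (.set 9 (.add (.var 8) (.const 1))) (.set 10 (.arr 2 (.var 8))))
            .skip) .skip) .skip)))

/-- The vertex in variable `7` takes the color whose successor is in variable `9`. -/
def takeColor : Stmt :=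
  .seq (.set 8 (.sub (.var 9) (.const 1)))
    (.seq (.store 3 (.arr 4 (.var 8)) (.const 0))
    (.seq (.store 3 (.add (.var 7) (.const 1)) (.add (.var 8) (.const 1)))
    (.seq (.store 4 (.var 8) (.add (.var 7) (.const 1)))
      (.store 2 (.var 8) (.add (.arr 2 (.var 8)) (.const 1))))))

/-- The vertex in variable `7` makes a bid. -/
def makeBid : Stmt :=
  .ite (.arr 3 (.add (.var 7) (.const 1))) .skip
    (.seq cheapestColor (.ite (.var 9) takeColor .skip))

/-- Every vertex makes a bid. -/
def bidRound : Stmt := .rep 7 vertexCount makeBid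

/-- Compute a maximum matching of the vertices and colors: prices in array `2`, matched colors of
the vertices in array `3`, matched vertices of the colors in array `4`. -/
def findMatching : Stmt :=
  .rep 5 (.add colorCount (.const 1)) (.rep 6 (.add colorCount (.const 1)) bidRound)

section

variable {I : ℕ → ℕ} {N n q s t : ℕ} {E : ℕ → ℕ → ℕ → Prop} (hI : IsInput I N n q s t E)
include hI

theorem cheapestColor_spec {v : ℕ} (hv : v < n) {σ : State} {A price : ℕ → ℕ}
    (h7 : σ.var 7 = v) (h1 : σ.arr 1 = A) (h2 : σ.arr 2 = price) :
    ((cheapestColor.eval I N σ).var 9 = 0 ∧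
        ∀ d < q, E s v d ∧ A (d * n + v) ≠ 0 → q + 1 ≤ price d) ∨
      ∃ c < q, (cheapestColor.eval I N σ).var 9 = c + 1 ∧ (E s v c ∧ A (c * n + v) ≠ 0) ∧
        price c < q + 1 ∧ ∀ d < q, E s v d ∧ A (d * n + v) ≠ 0 → price c ≤ price d := by
  rw [cheapestColor, Stmt.eval_seq, Stmt.eval_seq, Stmt.eval_rep, hI.eval_colorCount,
    min_eq_left hI.lt_len.le]
  have key := iterate_induction (x := 8)
    (f := (Stmt.ite (edgeBit source (.var 7) (.var 8))
        (.ite (.arr 1 (address (.var 8) (.var 7)))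
          (.ite (.sub (.var 10) (.arr 2 (.var 8)))
            (.seq (.set 9 (.add (.var 8) (.const 1))) (.set 10 (.arr 2 (.var 8))))
            .skip) .skip) .skip).eval I N)
    (σ := (Stmt.set 10 (.add colorCount (.const 1))).eval I N
      ((Stmt.set 9 (.const 0)).eval I N σ)) (m := q)
    (fun k τ => (τ.var 7 = v ∧ τ.arr 1 = A ∧ τ.arr 2 = price) ∧
      ((τ.var 9 = 0 ∧ τ.var 10 = q + 1 ∧
          ∀ d < k, E s v d ∧ A (d * n + v) ≠ 0 → q + 1 ≤ price d) ∨
        ∃ c < k, τ.var 9 = c + 1 ∧ τ.var 10 = price c ∧ (E s v c ∧ A (c * n + v) ≠ 0) ∧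
          price c < q + 1 ∧ ∀ d < k, E s v d ∧ A (d * n + v) ≠ 0 → price c ≤ price d))
    (by simp [Stmt.eval, Expr.eval, h7, h1, h2, hI.inp_one]) (by
      rintro k hk τ ⟨⟨g7, g1, g2⟩, hτ⟩
      refine ⟨⟨by rw [Stmt.eval_var _ (by rfl)]; simp [g7],
        by rw [Stmt.eval_arr _ (by rfl)]; simp [g1],
        by rw [Stmt.eval_arr _ (by rfl)]; simp [g2]⟩, ?_⟩
      have e1 := hI.edge s hI.source_lt v hv k hk
      -- A round that records nothing keeps the invariant unless `k` is available and strictly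
      -- cheaper.
      have skip : (E s v k ∧ A (k * n + v) ≠ 0 → τ.var 10 ≤ price k) →
          ((τ.setVar 8 k).var 9 = 0 ∧ (τ.setVar 8 k).var 10 = q + 1 ∧
          ∀ d < k + 1, E s v d ∧ A (d * n + v) ≠ 0 → q + 1 ≤ price d) ∨
          ∃ c < k + 1, (τ.setVar 8 k).var 9 = c + 1 ∧ (τ.setVar 8 k).var 10 = price c ∧
            (E s v c ∧ A (c * n + v) ≠ 0) ∧ price c < q + 1 ∧
            ∀ d < k + 1, E s v d ∧ A (d * n + v) ≠ 0 → price c ≤ price d := by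
        intro hkk
        simp only [State.setVar_var, show (9 : ℕ) ≠ 8 by decide, show (10 : ℕ) ≠ 8 by decide,
          if_false]
        rcases hτ with ⟨a1, a2, a3⟩ | ⟨c, a1, a2, a3, a4, a5, a6⟩
        · refine .inl ⟨a1, a2, fun d hd hvd => ?_⟩
          rcases Nat.lt_succ_iff_lt_or_eq.1 hd with hd | rfl
          · exact a3 d hd hvd
          · exact a2 ▸ hkk hvd
        · refine .inr ⟨c, by omega, a2, a3, a4, a5, fun d hd hvd => ?_⟩
          rcases Nat.lt_succ_iff_lt_or_eq.1 hd with hd | rfl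
          · exact a6 d hd hvd
          · exact a3 ▸ hkk hvd
      simp only [Stmt.eval]
      have f1 : (edgeBit source (.var 7) (.var 8)).eval I N (τ.setVar 8 k) ≠ 0 ↔ E s v k := by
        simp [Expr.eval, g7, hI.inp_zero, hI.inp_one, hI.inp_two, min_eq_left hI.le_len,
          min_eq_left (show q + 1 ≤ N from hI.lt_len), ← e1]
      have f2 : (Expr.arr 1 (address (.var 8) (.var 7))).eval I N (τ.setVar 8 k) =
          A (k * n + v) := by
        simp [Expr.eval, g7, g1, hI.inp_zero, min_eq_left hI.le_len]
      have f3 : (Expr.sub (.var 10) (.arr 2 (.var 8))).eval I N (τ.setVar 8 k) =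
          τ.var 10 - price k := by
        simp [Expr.eval, g2]
      simp only [f2, f3]
      split_ifs with b1 b2 b3
      · right
        refine ⟨k, by omega, by simp [Expr.eval], by simp [Expr.eval, g2], ⟨f1.1 b1, b2⟩, ?_, ?_⟩
        · rcases hτ with ⟨a1, a2, a3⟩ | ⟨c, a1, a2, a3, a4, a5, a6⟩ <;> omega
        · intro d hd hvd
          rcases Nat.lt_succ_iff_lt_or_eq.1 hd with hd | rfl
          · rcases hτ with ⟨a1, a2, a3⟩ | ⟨c, a1, a2, a3, a4, a5, a6⟩
            · have := a3 d hd hvd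
              omega
            · have := a6 d hd hvd
              omega
          · exact le_rfl
      · exact skip fun _ => by omega
      · exact skip fun h => absurd h.2 b2
      · exact skip fun h => b1 (f1.2 h.1) |>.elim)
  rcases key.2 with ⟨a1, a2, a3⟩ | ⟨c, a1, a2, a3, a4, a5, a6⟩
  · exact .inl ⟨a1, a3⟩
  · exact .inr ⟨c, a1, a2, a4, a5, a6⟩

/-- A vertex may be matched to a color if a route in this color starts with the vertex. -/
def IsStart (E : ℕ → ℕ → ℕ → Prop) (n s : ℕ) (A : ℕ → ℕ) (v c : ℕ) : Prop :=
  E s v c ∧ A (c * n + v) ≠ 0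

/-- The dichotomy behind termination: either the vertex is settled and the arrays stay as they are,
or the potential grows by exactly one. -/
theorem makeBid_spec {v : ℕ} (hv : v < n) {σ : State} {A : ℕ → ℕ}
    (h7 : σ.var 7 = v) (h1 : σ.arr 1 = A)
    (h : IsAuction (IsStart E n s A) n q (σ.arr 2) (σ.arr 3) (σ.arr 4)) :
    (Settled (IsStart E n s A) q (σ.arr 2) (σ.arr 3) v ∧
      ∀ i, (makeBid.eval I N σ).arr i = σ.arr i) ∨
    (¬ Settled (IsStart E n s A) q (σ.arr 2) (σ.arr 3) v ∧
      IsAuction (IsStart E n s A) n q ((makeBid.eval I N σ).arr 2) ((makeBid.eval I N σ).arr 3)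
        ((makeBid.eval I N σ).arr 4) ∧
      ∑ c ∈ Finset.range q, (makeBid.eval I N σ).arr 2 c =
        ∑ c ∈ Finset.range q, σ.arr 2 c + 1) := by
  have harr : ∀ i, (cheapestColor.eval I N σ).arr i = σ.arr i := fun i =>
    Stmt.eval_arr _ (by rfl) σ
  have hvar : (cheapestColor.eval I N σ).var 7 = v := by
    rw [Stmt.eval_var _ (by rfl), h7]
  by_cases hm : σ.arr 3 (v + 1) = 0
  · rw [makeBid, Stmt.eval, if_neg (by simp [Expr.eval, h7, hm]), Stmt.eval, Stmt.eval, Expr.eval]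
    rcases cheapestColor_spec hI hv h7 h1 rfl with ⟨a1, a2⟩ | ⟨c, a1, a2, a3, a4, a5⟩
    · rw [if_neg (by simp [a1])]
      exact .inl ⟨fun _ => a2, harr⟩
    · right
      rw [if_pos (by simp [a2])]
      refine ⟨fun hs => ?_, ?_, ?_⟩
      · have := hs hm c a1 a3
        omega
      · convert h.bid hv a1 hm a3 a4 a5 using 1 <;>
          simp [takeColor, Stmt.eval, Expr.eval, State.setArr_arr, harr, hvar, a2]
      · have h2 : (takeColor.eval I N (cheapestColor.eval I N σ)).arr 2 =
            Function.update (σ.arr 2) c (σ.arr 2 c + 1) := by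
          simp [takeColor, Stmt.eval, Expr.eval, State.setArr_arr, harr, hvar, a2]
        rw [h2, Finset.sum_update_of_mem (Finset.mem_range.2 a1),
          ← Finset.add_sum_erase _ _ (Finset.mem_range.2 a1), Finset.sdiff_singleton_eq_erase]
        omega
  · rw [makeBid, Stmt.eval, if_pos (by simpa [Expr.eval, h7] using hm)]
    exact .inl ⟨fun h => absurd h hm, fun _ => rfl⟩

/-- A round without a bid changes no array, so all vertices were settled; any other round raises the
total price. Thus `r` counts the rounds made so far. -/
theorem bidRound_spec {σ : State} {A : ℕ → ℕ} (h1 : σ.arr 1 = A)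
    (h : IsAuction (IsStart E n s A) n q (σ.arr 2) (σ.arr 3) (σ.arr 4)) {r : ℕ}
    (hr : (∀ v < n, Settled (IsStart E n s A) q (σ.arr 2) (σ.arr 3) v) ∨
      r ≤ ∑ c ∈ Finset.range q, σ.arr 2 c) :
    IsAuction (IsStart E n s A) n q ((bidRound.eval I N σ).arr 2) ((bidRound.eval I N σ).arr 3)
        ((bidRound.eval I N σ).arr 4) ∧
      ((∀ v < n, Settled (IsStart E n s A) q ((bidRound.eval I N σ).arr 2)
          ((bidRound.eval I N σ).arr 3) v) ∨
        r + 1 ≤ ∑ c ∈ Finset.range q, (bidRound.eval I N σ).arr 2 c) := by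
  rw [bidRound, Stmt.eval, hI.eval_vertexCount, min_eq_left hI.le_len]
  by_cases hs : ∀ v < n, Settled (IsStart E n s A) q (σ.arr 2) (σ.arr 3) v
  · have key := iterate_induction (x := 7) (f := makeBid.eval I N) (σ := σ) (m := n)
      (fun _ τ => ∀ i, τ.arr i = σ.arr i) (fun _ => rfl) (by
        intro v hv τ hτ
        rcases makeBid_spec hI hv (σ := τ.setVar 7 v) (A := A) (by simp) (by simp [hτ, h1])
          (by simpa [hτ] using h) with ⟨-, a⟩ | ⟨a, -⟩
        · exact fun i => (a i).trans (hτ i)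
        · exact absurd (hs v hv) (by simpa [hτ] using a))
    simp only [key]
    exact ⟨h, .inl hs⟩
  · replace hr := hr.resolve_left hs
    have key := iterate_induction (x := 7) (f := makeBid.eval I N) (σ := σ) (m := n)
      (fun k τ => τ.arr 1 = A ∧
        IsAuction (IsStart E n s A) n q (τ.arr 2) (τ.arr 3) (τ.arr 4) ∧
        r ≤ ∑ c ∈ Finset.range q, τ.arr 2 c ∧
        ((∀ v < k, Settled (IsStart E n s A) q (τ.arr 2) (τ.arr 3) v) ∨
          r + 1 ≤ ∑ c ∈ Finset.range q, τ.arr 2 c)) ⟨h1, h, hr, by simp⟩ (by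
        rintro v hv τ ⟨g1, g2, g3, g4⟩
        refine ⟨(Stmt.eval_arr _ (by rfl) _).trans g1, ?_⟩
        rcases makeBid_spec hI hv (σ := τ.setVar 7 v) (A := A) (by simp) g1 g2 with
          ⟨a1, a2⟩ | ⟨-, a2, a3⟩
        · simp only [a2]
          refine ⟨g2, g3, g4.imp_left fun g4 w hw => ?_⟩
          rcases Nat.lt_succ_iff_lt_or_eq.1 hw with hw | rfl
          · exact g4 w hw
          · exact a1
        · simp only [State.setVar_arr] at a3
          exact ⟨a2, by omega, .inr (by omega)⟩)
    exact ⟨key.2.1, key.2.2.2⟩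

/-- A single loop is cut off at `N`, so two nested loops provide `(q + 1) * (q + 1)` rounds. This
exceeds the largest possible total price `q * (q + 1)`, which leaves only the settled case. -/
theorem findMatching_spec {σ : State} {A : ℕ → ℕ} (h1 : σ.arr 1 = A) (h2 : σ.arr 2 = fun _ => 0)
    (h3 : σ.arr 3 = fun _ => 0) (h4 : σ.arr 4 = fun _ => 0) :
    IsAuction (IsStart E n s A) n q ((findMatching.eval I N σ).arr 2)
        ((findMatching.eval I N σ).arr 3) ((findMatching.eval I N σ).arr 4) ∧
      ∀ v < n, Settled (IsStart E n s A) q ((findMatching.eval I N σ).arr 2)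
        ((findMatching.eval I N σ).arr 3) v := by
  have hq : ∀ τ, min ((Expr.add colorCount (.const 1)).eval I N τ) N = q + 1 := fun τ => by
    rw [Expr.eval, hI.eval_colorCount]
    exact min_eq_left hI.lt_len
  let P : ℕ → State → Prop := fun r τ => τ.arr 1 = A ∧
    IsAuction (IsStart E n s A) n q (τ.arr 2) (τ.arr 3) (τ.arr 4) ∧
    ((∀ v < n, Settled (IsStart E n s A) q (τ.arr 2) (τ.arr 3) v) ∨
      r ≤ ∑ c ∈ Finset.range q, τ.arr 2 c)
  have key : P ((q + 1) * (q + 1)) (findMatching.eval I N σ) := by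
    rw [findMatching, Stmt.eval, hq]
    refine iterate_induction (fun k => P (k * (q + 1))) ?_ fun k hk τ hτ => ?_
    · refine ⟨h1, ?_, .inr (by simp)⟩
      rw [h2, h3, h4]
      constructor <;> simp
    · rw [Stmt.eval, hq, add_mul, one_mul]
      refine iterate_induction (fun l => P (k * (q + 1) + l)) hτ fun l hl τ hτ => ?_
      exact ⟨(Stmt.eval_arr _ (by rfl) _).trans hτ.1,
        bidRound_spec hI (σ := τ.setVar 6 l) hτ.1 hτ.2.1 hτ.2.2⟩
  refine ⟨key.2.1, key.2.2.resolve_right fun hr => ?_⟩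
  have := key.2.1.sum_le
  nlinarith

end

end MaxCDDP

/-! ### Output of the solution -/

namespace MaxCDDP

open RAM

/-- The first cells of the array `0` contain the word `w`, and the variable `0` its length. -/
def Written (σ : State) (w : List ℕ) : Prop :=
  σ.var 0 = w.length ∧ ∀ (i : ℕ) (hi : i < w.length), σ.arr 0 i = w[i]

/-- Append a number to the output. -/
def emit (e : Expr) : Stmt :=
  .seq (.store 0 (.var 0) e) (.set 0 (.add (.var 0) (.const 1)))

/-- Append the vertices before the target of the route in the color in variable `12` that starts
in the vertex in variable `14`. -/
def writeRoute : Stmt :=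
  .rep 15 vertexCount (.ite (.add (.sub (.var 14) target) (.sub target (.var 14)))
    (.seq (emit (.var 14))
      (.set 14 (.sub (.arr 1 (address (.var 12) (.var 14))) (.const 1)))) .skip)

/-- Append the color and the path that belong to the vertex in variable `11`. -/
def writePath : Stmt :=
  .seq (.set 12 (.sub (.arr 3 (.add (.var 11) (.const 1))) (.const 1)))
    (.seq (emit (.var 12)) (.seq (.set 13 (.var 0)) (.seq (emit (.const 0)) (.seq (emit source)
    (.seq (.set 14 (.var 11)) (.seq writeRoute (.seq (emit target)
      (.store 0 (.var 13) (.sub (.sub (.var 0) (.var 13)) (.const 1))))))))))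

/-- Write the number of paths, the colors and the paths. -/
def writeSolution : Stmt :=
  .seq (.set 0 (.const 0)) (.seq (emit (.const 0)) (.seq (.set 16 (.const 0))
    (.seq (.rep 11 vertexCount (.ite (.arr 3 (.add (.var 11) (.const 1)))
      (.seq (.set 16 (.add (.var 16) (.const 1))) writePath) .skip))
    (.store 0 (.const 0) (.var 16)))))

/-- The program for MaxCDDP. -/
def solve : Stmt := .seq findRoutes (.seq findMatching writeSolution)

theorem Written.setVar {σ : State} {w : List ℕ} (h : Written σ w) {x k : ℕ} (hx : x ≠ 0) :
    Written (σ.setVar x k) w :=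
  ⟨by simpa [hx.symm] using h.1, h.2⟩

theorem Written.emit {I : ℕ → ℕ} {N : ℕ} {σ : State} {w : List ℕ} (h : Written σ w) {e : Expr}
    {b : ℕ} (hb : e.eval I N σ = b) : Written ((emit e).eval I N σ) (w ++ [b]) := by
  refine ⟨by simp [MaxCDDP.emit, Stmt.eval, Expr.eval, h.1], fun i hi => ?_⟩
  simp only [MaxCDDP.emit, Stmt.eval, Expr.eval, State.setVar_arr, State.setArr_arr, if_true, h.1,
    hb, Function.update_apply]
  rw [List.length_append, List.length_singleton] at hi
  split_ifs with hiw
  · simp [hiw]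
  · rw [List.getElem_append_left (by omega)]
    exact h.2 i (by omega)

/-- Placeholders for the path lengths and for the number of paths are filled in this way. -/
theorem Written.setArr {σ : State} {u w : List ℕ} {a b : ℕ} (h : Written σ (u ++ a :: w)) :
    Written (σ.setArr 0 u.length b) (u ++ b :: w) := by
  refine ⟨by simpa using h.1, fun i hi => ?_⟩
  have := h.2 i (by simpa using hi)
  rw [State.setArr_arr, if_pos rfl, Function.update_apply]
  split_ifs with hiu
  · simp [hiu]
  · rw [this]
    by_cases hlt : i < u.length
    · simp [List.getElem_append_left hlt]
    · obtain ⟨j, rfl⟩ : ∃ j, i = u.length + 1 + j := ⟨i - (u.length + 1), by omega⟩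
      simp [List.getElem_append_right, add_assoc, Nat.add_comm 1 j]

theorem emit_var {I : ℕ → ℕ} {N : ℕ} {σ : State} {e : Expr} {x : ℕ} (hx : x ≠ 0) :
    ((emit e).eval I N σ).var x = σ.var x :=
  Stmt.eval_var _ (by simp [emit, Stmt.setsVar, hx.symm]) σ

theorem emit_arr {I : ℕ → ℕ} {N : ℕ} {σ : State} {e : Expr} {a : ℕ} (ha : a ≠ 0) :
    ((emit e).eval I N σ).arr a = σ.arr a :=
  Stmt.eval_arr _ (by simp [emit, Stmt.setsArr, ha.symm]) σ

section

variable {I : ℕ → ℕ} {N n q s t : ℕ} {E : ℕ → ℕ → ℕ → Prop} (hI : IsInput I N n q s t E)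
include hI

/-- The output followed by the rest of the route is invariant. Each round moves one vertex until
only `t` is left; `n` rounds suffice because a route has at most `n` vertices. The target is left to
the caller. -/
theorem writeRoute_spec {σ : State} {w l : List ℕ} {A : ℕ → ℕ} {c x : ℕ} (h : Written σ w)
    (h1 : σ.arr 1 = A) (h12 : σ.var 12 = c) (h14 : σ.var 14 = x)
    (hl : Route E n s t c (fun y => A (c * n + y)) x l) :
    ∃ w', Written (writeRoute.eval I N σ) w' ∧ w' ++ [t] = w ++ l := by
  rw [writeRoute, Stmt.eval_rep, hI.eval_vertexCount, min_eq_left hI.le_len]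
  have key := iterate_induction (x := 15) (σ := σ) (m := n)
    (f := (Stmt.ite (.add (.sub (.var 14) target) (.sub target (.var 14)))
      (.seq (emit (.var 14))
        (.set 14 (.sub (.arr 1 (address (.var 12) (.var 14))) (.const 1)))) .skip).eval I N)
    (fun k τ => τ.arr 1 = A ∧ τ.var 12 = c ∧ ∃ w' x' l', Written τ w' ∧ τ.var 14 = x' ∧
      Route E n s t c (fun y => A (c * n + y)) x' l' ∧ w' ++ l' = w ++ l ∧
      (l' = [t] ∨ l'.length + k ≤ l.length))
    ⟨h1, h12, w, x, l, h, h14, hl, rfl, .inr (by omega)⟩ (by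
      rintro k hk τ ⟨g1, g12, w', x', l', g2, g3, g4, g5, g6⟩
      refine ⟨(Stmt.eval_arr _ (by rfl) _).trans g1, (Stmt.eval_var _ (by rfl) _).trans
        (by simpa using g12), ?_⟩
      have e1 : (Expr.add (.sub (.var 14) target) (.sub target (.var 14))).eval I N
          (τ.setVar 15 k) = (x' - t) + (t - x') := by
        simp [Expr.eval, hI.inp_three, g3]
      rw [Stmt.eval, e1]
      cases g4 with
      | nil =>
        rw [if_neg (by omega)]
        exact ⟨w', t, [t], g2.setVar (by omega), by simpa [Stmt.eval] using g3, .nil, g5, .inl rfl⟩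
      | @cons _ y l' a1 a2 a3 a4 a5 a6 a7 a8 =>
        rw [if_pos (by omega)]
        refine ⟨w' ++ [x'], y, l', ?_, ?_, a8, by simpa using g5, ?_⟩
        · rw [Stmt.eval_seq, Stmt.eval]
          exact ((g2.setVar (by omega)).emit (by simpa [Expr.eval] using g3)).setVar (by omega)
        · rw [Stmt.eval_seq, Stmt.eval]
          simp [Expr.eval, emit_var, emit_arr, g12, g3, g1, hI.inp_zero, min_eq_left hI.le_len, a5]
        · rcases g6 with g6 | g6
          · obtain ⟨rfl, rfl⟩ := List.cons_eq_cons.1 g6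
            exact absurd rfl a2
          · right
            rw [List.length_cons] at g6
            omega)
  obtain ⟨-, -, w', x', l', g2, g3, g4, g5, g6⟩ := key
  refine ⟨w', g2, ?_⟩
  rw [← g5]
  rcases g6 with rfl | g6
  · rfl
  · have := hl.length_le hI.target_lt
    have h0 : l' = [] := List.eq_nil_of_length_eq_zero (by omega)
    subst h0
    cases g4

theorem writePath_spec {σ : State} {w l : List ℕ} {A : ℕ → ℕ} {c v : ℕ} (h : Written σ w)
    (h1 : σ.arr 1 = A) (h11 : σ.var 11 = v) (hc : σ.arr 3 (v + 1) = c + 1)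
    (hl : Route E n s t c (fun y => A (c * n + y)) v l) :
    Written (writePath.eval I N σ) (w ++ c :: (l.length + 1) :: s :: l) := by
  simp only [writePath, Stmt.eval_seq]
  set σ1 := (Stmt.set 12 (.sub (.arr 3 (.add (.var 11) (.const 1))) (.const 1))).eval I N σ
  have v12 : σ1.var 12 = c := by simp [σ1, Stmt.eval, Expr.eval, h11, hc]
  have w1 : Written σ1 w := h.setVar (by omega)
  set σ2 := (emit (.var 12)).eval I N σ1
  have w2 : Written σ2 (w ++ [c]) := w1.emit v12
  set σ3 := (Stmt.set 13 (.var 0)).eval I N σ2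
  have v13 : σ3.var 13 = (w ++ [c]).length := by simpa [σ3, Stmt.eval, Expr.eval] using w2.1
  have w3 : Written σ3 (w ++ [c]) := w2.setVar (by omega)
  set σ4 := (emit (.const 0)).eval I N σ3
  have w4 : Written σ4 (w ++ [c] ++ [0]) := w3.emit rfl
  set σ5 := (emit source).eval I N σ4
  have w5 : Written σ5 (w ++ [c] ++ [0] ++ [s]) := w4.emit (hI.eval_source _)
  set σ6 := (Stmt.set 14 (.var 11)).eval I N σ5
  have w6 : Written σ6 (w ++ [c] ++ [0] ++ [s]) := w5.setVar (by omega)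
  have v11 : σ5.var 11 = v := by
    simp [σ5, σ4, σ3, σ2, σ1, emit_var, Stmt.eval, h11]
  have v12' : σ6.var 12 = c := by
    simp [σ6, σ5, σ4, σ3, σ2, emit_var, Stmt.eval, v12]
  have a1 : σ6.arr 1 = A := by
    simp [σ6, σ5, σ4, σ3, σ2, σ1, emit_arr, Stmt.eval, h1]
  have v13' : σ6.var 13 = (w ++ [c]).length := by
    rw [← v13]
    simp [σ6, σ5, σ4, emit_var, Stmt.eval]
  obtain ⟨w', w7, hw'⟩ := writeRoute_spec hI w6 a1 v12'
    (by simpa [σ6, Stmt.eval, Expr.eval] using v11) hl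
  set σ7 := writeRoute.eval I N σ6
  have v13'' : σ7.var 13 = (w ++ [c]).length := (Stmt.eval_var _ (by rfl) _).trans v13'
  set σ8 := (emit target).eval I N σ7
  have w8 : Written σ8 (w ++ [c] ++ 0 :: s :: l) := by
    have := w7.emit (e := target) (hI.eval_target _)
    rw [hw'] at this
    simpa using this
  have v13f : σ8.var 13 = (w ++ [c]).length := by rw [← v13'']; exact emit_var (by omega)
  have hv : (Expr.sub (.sub (.var 0) (.var 13)) (.const 1)).eval I N σ8 = l.length + 1 := by
    simp only [Expr.eval, v13f, w8.1, List.length_append, List.length_cons]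
    omega
  rw [Stmt.eval, hv, Expr.eval, v13f]
  simpa using w8.setArr (b := l.length + 1)

theorem writeSolution_spec {σ : State} {A mate : ℕ → ℕ} (h1 : σ.arr 1 = A) (h3 : σ.arr 3 = mate)
    (r : ℕ → List ℕ) (hr : ∀ v < n, ∀ c, mate (v + 1) = c + 1 →
      Route E n s t c (fun y => A (c * n + y)) v (r v)) :
    Written (writeSolution.eval I N σ)
      (((List.range n).filter fun v => mate (v + 1) ≠ 0).length ::
        (List.range n).flatMap fun v => if mate (v + 1) = 0 then [] else
          (mate (v + 1) - 1) :: ((r v).length + 1) :: s :: r v) := by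
  simp only [writeSolution, Stmt.eval_seq]
  rw [Stmt.eval_rep, hI.eval_vertexCount, min_eq_left hI.le_len]
  have key := iterate_induction (x := 11) (m := n)
    (σ := (Stmt.set 16 (.const 0)).eval I N ((emit (.const 0)).eval I N
      ((Stmt.set 0 (.const 0)).eval I N σ)))
    (f := (Stmt.ite (.arr 3 (.add (.var 11) (.const 1)))
      (.seq (.set 16 (.add (.var 16) (.const 1))) writePath) .skip).eval I N)
    (fun k τ => τ.arr 1 = A ∧ τ.arr 3 = mate ∧
      τ.var 16 = ((List.range k).filter fun v => mate (v + 1) ≠ 0).length ∧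
      Written τ (0 :: (List.range k).flatMap fun v => if mate (v + 1) = 0 then [] else
          (mate (v + 1) - 1) :: ((r v).length + 1) :: s :: r v))
    ⟨by simp [Stmt.eval, emit_arr, h1], by simp [Stmt.eval, emit_arr, h3],
      by simp [Stmt.eval, Expr.eval], by
        have : Written ((Stmt.set 0 (.const 0)).eval I N σ) [] := by
          simp [Written, Stmt.eval, Expr.eval]
        exact (this.emit (by rfl)).setVar (by omega)⟩ (by
      rintro k hk τ ⟨g1, g3, g16, g0⟩
      refine ⟨(Stmt.eval_arr _ (by rfl) _).trans g1, (Stmt.eval_arr _ (by rfl) _).trans g3, ?_⟩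
      rw [Stmt.eval, show (Expr.arr 3 (.add (.var 11) (.const 1))).eval I N (τ.setVar 11 k) =
        mate (k + 1) by simp [Expr.eval, g3]]
      simp only [List.range_succ, List.filter_append, List.flatMap_append, List.flatMap_singleton,
        List.length_append]
      by_cases hm : mate (k + 1) = 0
      · simp only [hm, ne_eq, not_true_eq_false, if_false, if_true, List.append_nil]
        exact ⟨by simpa [Stmt.eval, hm] using g16, g0.setVar (by omega)⟩
      · rw [if_pos hm, if_neg hm, Stmt.eval_seq]
        obtain ⟨c, hc⟩ : ∃ c, mate (k + 1) = c + 1 := ⟨mate (k + 1) - 1, by omega⟩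
        refine ⟨?_, ?_⟩
        · rw [Stmt.eval_var _ (by rfl)]
          simp [Stmt.eval, Expr.eval, g16, hm]
        · rw [hc, Nat.add_sub_cancel, ← List.cons_append]
          exact writePath_spec hI ((g0.setVar (by omega)).setVar (by omega)) g1
            (by simp [Stmt.eval]) (by simpa [Stmt.eval, g3] using hc) (hr k hk c hc))
  obtain ⟨-, -, g16, g0⟩ := key
  rw [← g16]
  exact Written.setArr (u := []) g0

/-- The program writes the routes that belong to a maximum matching. -/
theorem solve_spec : ∃ (A mate : ℕ → ℕ) (price owner : ℕ → ℕ) (r : ℕ → List ℕ),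
    IsAuction (IsStart E n s A) n q price mate owner ∧
    (∀ v < n, Settled (IsStart E n s A) q price mate v) ∧
    (∀ c < q, ∀ x, Reach E n s t c n x → A (c * n + x) ≠ 0) ∧
    (∀ v < n, ∀ c, mate (v + 1) = c + 1 →
      Route E n s t c (fun y => A (c * n + y)) v (r v)) ∧
    Written (solve.eval I N zeroState)
      (((List.range n).filter fun v => mate (v + 1) ≠ 0).length ::
        (List.range n).flatMap fun v => if mate (v + 1) = 0 then [] else
          (mate (v + 1) - 1) :: ((r v).length + 1) :: s :: r v) := by
  obtain ⟨a1, a2⟩ := findRoutes_spec hI (σ := zeroState) rfl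
  set σ := findRoutes.eval I N zeroState
  obtain ⟨b1, b2⟩ := findMatching_spec hI (σ := σ) (A := σ.arr 1) rfl
    (Stmt.eval_arr _ (by rfl) _) (Stmt.eval_arr _ (by rfl) _) (Stmt.eval_arr _ (by rfl) _)
  set τ := findMatching.eval I N σ with hτ
  have hr : ∀ v, ∃ l, v < n → ∀ c, τ.arr 3 (v + 1) = c + 1 →
      Route E n s t c (fun y => σ.arr 1 (c * n + y)) v l := by
    intro v
    by_cases h : v < n ∧ ∃ c, τ.arr 3 (v + 1) = c + 1
    · obtain ⟨hv, c, hc⟩ := h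
      obtain ⟨l, hl⟩ := a1.route c (b1.color_lt v c hc) v hv (b1.adj v c hc).2
      refine ⟨l, fun _ d hd => ?_⟩
      obtain rfl : c = d := by omega
      exact hl
    · exact ⟨[], fun hv c hc => absurd ⟨hv, c, hc⟩ h⟩
  choose r hr using hr
  refine ⟨σ.arr 1, τ.arr 3, _, _, r, b1, b2, a2, hr, ?_⟩
  rw [solve, Stmt.eval_seq, Stmt.eval_seq]
  exact writeSolution_spec hI (Stmt.eval_arr _ (by rfl) _) rfl r hr

end

end MaxCDDP

/-! ### The encoded instance and the main theorem -/

theorem List.length_flatMap_of_length_eq {α β : Type*} {f : α → List β} {m : ℕ} (l : List α)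
    (hf : ∀ a, (f a).length = m) : (l.flatMap f).length = l.length * m := by
  induction l with
  | nil => simp
  | cons a l ih => simp [hf, ih, add_mul, add_comm]

/-- Applied twice, this reads an entry of the encoded adjacency table. -/
theorem List.getElem?_flatMap_of_length_eq {α β : Type*} {f : α → List β} {m : ℕ}
    (hf : ∀ a, (f a).length = m) {j : ℕ} (hj : j < m) (l : List α) :
    ∀ (i : ℕ) (hi : i < l.length), (l.flatMap f)[i * m + j]? = (f l[i])[j]? := by
  induction l with
  | nil => simp
  | cons a l ih =>
    intro i hi
    rw [List.flatMap_cons]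
    cases i with
    | zero =>
      rw [List.getElem?_append_left (by simpa [hf] using hj)]
      simp
    | succ i =>
      rw [List.getElem?_append_right (by rw [hf]; nlinarith), hf,
        show (i + 1) * m + j - m = i * m + j by rw [add_mul, one_mul]; omega]
      simpa using ih i (by simpa using hi)

namespace MaxCDDP

open RAM

/-- There is an edge from `x` to `y` that carries the color `c`. -/
def Instance.Edge (I : Instance) (x y c : ℕ) : Prop :=
  ∃ (hx : x < I.n) (hy : y < I.n) (hc : c < I.q) (h : I.G.graph.Adj ⟨x, hx⟩ ⟨y, hy⟩),
    ⟨c, hc⟩ ∈ I.G.color ⟨s(⟨x, hx⟩, ⟨y, hy⟩), h⟩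

theorem Instance.length_encode (I : Instance) :
    I.encode.length = 4 + I.n * (I.n * (I.q + 1)) := by
  rw [Instance.encode, List.length_append, List.length_flatMap_of_length_eq (m := I.n * (I.q + 1))]
  · simp
  · intro u
    rw [List.length_flatMap_of_length_eq (m := I.q + 1)] <;> simp

theorem Instance.encode_edge (I : Instance) {x y c : ℕ} (hx : x < I.n) (hy : y < I.n)
    (hc : c < I.q) :
    I.encode.getD (5 + c + (x * I.n + y) * (I.q + 1)) 0 ≠ 0 ↔ I.Edge x y c := by
  classical
  -- Header, row, block, and position in the block, where `c + 1` skips the adjacency bit.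
  have h1 : 5 + c + (x * I.n + y) * (I.q + 1) =
      4 + (x * (I.n * (I.q + 1)) + (y * (I.q + 1) + (c + 1))) := by ring
  have hlt : y * (I.q + 1) + (c + 1) < I.n * (I.q + 1) := by nlinarith
  rw [List.getD_eq_getElem?_getD, h1, Instance.encode, List.getElem?_append_right (by simp),
    List.length_cons, List.length_cons, List.length_cons, List.length_singleton,
    Nat.add_sub_cancel_left, List.getElem?_flatMap_of_length_eq (m := I.n * (I.q + 1)) _ hlt _ x
      (by simpa using hx),
    List.getElem?_flatMap_of_length_eq (m := I.q + 1) _ (by omega) _ y (by simpa using hy)]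
  · simp [Instance.Edge, hx, hy, hc]
  · simp
  · intro u
    rw [List.length_flatMap_of_length_eq (m := I.q + 1)] <;> simp

theorem Instance.isInput (I : Instance) :
    IsInput (fun i => I.encode.getD i 0) I.encode.length I.n I.q I.s I.t I.Edge where
  inp_zero := by simp [Instance.encode]
  inp_one := by simp [Instance.encode]
  inp_two := by simp [Instance.encode]
  inp_three := by simp [Instance.encode]
  le_len := by
    have := I.s.pos
    rw [I.length_encode]
    nlinarith [Nat.zero_le (I.n * (I.n * I.q))]
  lt_len := by
    have h1 : 1 ≤ I.n * I.n := Nat.mul_pos I.s.pos I.s.pos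
    rw [I.length_encode]
    nlinarith
  source_lt := I.s.2
  target_lt := I.t.2
  source_ne_target := fun h => I.s_ne_t (Fin.ext h)
  edge := fun _ hx _ hy _ hc => I.encode_edge hx hy hc

variable {I : Instance}

/-! ### From routes to paths and back -/

theorem Route.source_notMem {E : ℕ → ℕ → ℕ → Prop} {n s t c x : ℕ} {g : ℕ → ℕ} {l : List ℕ}
    (h : Route E n s t c g x l) (hst : s ≠ t) : s ∉ l := by
  induction h with
  | nil => simpa using hst
  | cons h _ _ _ _ _ _ _ ih => simp [h.symm, ih]

theorem Route.exists_walk {c x : ℕ} {g : ℕ → ℕ} {l : List ℕ}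
    (h : Route I.Edge I.n I.s I.t c g x l) (hx : x < I.n) (hc : c < I.q) :
    ∃ p : I.G.graph.Walk ⟨x, hx⟩ I.t, p.support.map (fun v : Fin _ => (v : ℕ)) = l ∧
      ∀ e : I.G.graph.edgeSet, (e : Sym2 (Fin I.n)) ∈ p.edges → ⟨c, hc⟩ ∈ I.G.color e := by
  induction h with
  | nil => exact ⟨.nil, by simp, by simp⟩
  | cons a1 a2 a3 a4 a5 a6 a7 a8 ih =>
    obtain ⟨p, hp1, hp2⟩ := ih a4
    obtain ⟨_, _, _, hadj, hcol⟩ := a6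
    refine ⟨.cons hadj p, by simp [hp1], fun e he => ?_⟩
    rw [SimpleGraph.Walk.edges_cons, List.mem_cons] at he
    rcases he with he | he
    · obtain rfl : e = ⟨_, hadj⟩ := Subtype.ext he
      exact hcol
    · exact hp2 e he

theorem IsStart.exists_path {A : ℕ → ℕ} {v c : ℕ} {l : List ℕ}
    (h : IsStart I.Edge I.n I.s A v c)
    (hl : Route I.Edge I.n I.s I.t c (fun y => A (c * I.n + y)) v l) :
    ∃ x : I.G.graph.Path I.s I.t × Fin I.q, I.G.Colored x.1 x.2 ∧ (x.2 : ℕ) = c ∧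
      ((x.1 : I.G.graph.Walk I.s I.t).snd : ℕ) = v ∧
      (x.1 : I.G.graph.Walk I.s I.t).support.map (fun v : Fin _ => (v : ℕ)) =
        (I.s : ℕ) :: l := by
  obtain ⟨⟨_, hv, hc, hadj, hcol⟩, -⟩ := h
  obtain ⟨p, hp1, hp2⟩ := hl.exists_walk hv hc
  have hs : (SimpleGraph.Walk.cons hadj p).support.map (fun v : Fin _ => (v : ℕ)) =
      (I.s : ℕ) :: l := by
    simp [hp1]
  have hpath : (SimpleGraph.Walk.cons hadj p).IsPath := by
    rw [SimpleGraph.Walk.isPath_def]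
    refine List.Nodup.of_map (fun v : Fin _ => (v : ℕ)) ?_
    rw [hs]
    exact List.nodup_cons.2 ⟨hl.source_notMem fun h => I.s_ne_t (Fin.ext h), hl.nodup⟩
  refine ⟨(⟨_, hpath⟩, ⟨c, hc⟩), fun e he => ?_, rfl, by simp, hs⟩
  rw [SimpleGraph.Walk.edges_cons, List.mem_cons] at he
  rcases he with he | he
  · obtain rfl : e = ⟨_, hadj⟩ := Subtype.ext he
    exact hcol
  · exact hp2 e he

/-- The end and the forbidden vertex are variables tied to `t` and `s` by equations, so that
induction on the walk applies. -/
theorem reach_of_walk {c : Fin I.q} {u v w : Fin I.n} (p : I.G.graph.Walk u v) (hv : v = I.t)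
    (hw : w = I.s) (hp : w ∉ p.support)
    (hc : ∀ e : I.G.graph.edgeSet, (e : Sym2 (Fin I.n)) ∈ p.edges → c ∈ I.G.color e) :
    Reach I.Edge I.n I.s I.t c p.length u := by
  induction p with
  | nil =>
    subst hv
    exact .nil _
  | @cons a b _ hadj p ih =>
    rw [SimpleGraph.Walk.support_cons, List.mem_cons, not_or] at hp
    refine .cons (fun h => hp.1 (hw.trans (Fin.ext h.symm))) a.2 b.2
      ⟨a.2, b.2, c.2, hadj, hc ⟨_, hadj⟩ (by simp)⟩ (ih hv hp.2 fun e he => hc e (by simp [he]))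

/-- The color of a path from the source is available to the second vertex. -/
theorem isStart_of_colored {A : ℕ → ℕ}
    (hA : ∀ c < I.q, ∀ x, Reach I.Edge I.n I.s I.t c I.n x → A (c * I.n + x) ≠ 0)
    {p : I.G.graph.Path I.s I.t} {c : Fin I.q} (h : I.G.Colored p c) :
    IsStart I.Edge I.n I.s A (p : I.G.graph.Walk I.s I.t).snd c := by
  obtain ⟨p, hp⟩ := p
  have key : ∀ (u : Fin I.n) (p : I.G.graph.Walk u I.t), p.IsPath → u = I.s →
      (∀ e : I.G.graph.edgeSet, (e : Sym2 (Fin I.n)) ∈ p.edges → c ∈ I.G.color e) →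
      IsStart I.Edge I.n I.s A p.snd c := by
    intro u p hp hu hc
    cases p with
    | nil => exact absurd hu.symm I.s_ne_t
    | @cons _ b _ hadj p =>
      -- A path has fewer than `n` edges, so `n` passes find its tail.
      have hlen := hp.length_lt
      rw [SimpleGraph.Walk.length_cons, Fintype.card_fin] at hlen
      rw [SimpleGraph.Walk.cons_isPath_iff] at hp
      subst hu
      rw [SimpleGraph.Walk.snd_cons]
      exact ⟨⟨I.s.2, b.2, c.2, hadj, hc ⟨_, hadj⟩ (by simp)⟩, hA c c.2 b
        ((reach_of_walk p rfl rfl hp.2 fun e he => hc e (by simp [he])).mono (by omega))⟩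
  exact key I.s p hp rfl h

/-- The pairs of second vertex and color form a matching in the graph of the auction, and no
matching there beats the result of the auction. -/
theorem card_le_of_isSolution {A price mate owner : ℕ → ℕ}
    (h : IsAuction (IsStart I.Edge I.n I.s A) I.n I.q price mate owner)
    (hs : ∀ v < I.n, Settled (IsStart I.Edge I.n I.s A) I.q price mate v)
    (hA : ∀ c < I.q, ∀ x, Reach I.Edge I.n I.s I.t c I.n x → A (c * I.n + x) ≠ 0)
    {S : Finset (I.G.graph.Path I.s I.t × Fin I.q)} (hS : I.G.IsSolution S) :
    S.card ≤ ((Finset.range I.n).filter fun v => mate (v + 1) ≠ 0).card := by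
  let f : I.G.graph.Path I.s I.t × Fin I.q → ℕ × ℕ :=
    fun x => ((x.1 : I.G.graph.Walk I.s I.t).snd, x.2)
  have h1 : ∀ x ∈ S, ∀ y ∈ S, (f x).1 = (f y).1 → x = y := by
    intro x hx y hy hxy
    by_contra hne
    exact hS.snd_ne I.s_ne_t hx hy hne (Fin.ext hxy)
  have h2 : ∀ x ∈ S, ∀ y ∈ S, (f x).2 = (f y).2 → x = y := by
    intro x hx y hy hxy
    by_contra hne
    exact (hS.2 x hx y hy hne).2.1 (Fin.ext hxy)
  have hinj : Set.InjOn f S := fun x hx y hy hxy => h1 x hx y hy (congrArg Prod.fst hxy)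
  rw [← Finset.card_image_of_injOn hinj]
  refine h.card_le hs _ ?_ ?_ ?_
  · intro z hz
    obtain ⟨x, hx, rfl⟩ := Finset.mem_image.1 hz
    exact ⟨Fin.is_lt _, Fin.is_lt _, isStart_of_colored hA (hS.1 x hx)⟩
  · intro z hz w hw hzw
    obtain ⟨x, hx, rfl⟩ := Finset.mem_image.1 hz
    obtain ⟨y, hy, rfl⟩ := Finset.mem_image.1 hw
    rw [h1 x hx y hy hzw]
  · intro z hz w hw hzw
    obtain ⟨x, hx, rfl⟩ := Finset.mem_image.1 hz
    obtain ⟨y, hy, rfl⟩ := Finset.mem_image.1 hw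
    rw [h2 x hx y hy hzw]

theorem Instance.encodePaths_eq (L : List (I.G.graph.Path I.s I.t × Fin I.q)) :
    I.encodePaths L = L.length :: L.flatMap fun x =>
      (x.2 : ℕ) :: (x.1 : I.G.graph.Walk I.s I.t).support.length ::
        (x.1 : I.G.graph.Walk I.s I.t).support.map fun v : Fin _ => (v : ℕ) := by
  simp [Instance.encodePaths, List.map_eq_flatMap]

/-- The matching and the routes give an optimal solution. -/
theorem isOptimalOutput_of_auction (hT : (I.G.deleteTarget I.t).IsTree)
    {A price mate owner : ℕ → ℕ} {r : ℕ → List ℕ}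
    (h : IsAuction (IsStart I.Edge I.n I.s A) I.n I.q price mate owner)
    (hs : ∀ v < I.n, Settled (IsStart I.Edge I.n I.s A) I.q price mate v)
    (hA : ∀ c < I.q, ∀ x, Reach I.Edge I.n I.s I.t c I.n x → A (c * I.n + x) ≠ 0)
    (hr : ∀ v < I.n, ∀ c, mate (v + 1) = c + 1 →
      Route I.Edge I.n I.s I.t c (fun y => A (c * I.n + y)) v (r v)) :
    I.IsOptimalOutput (((List.range I.n).filter fun v => mate (v + 1) ≠ 0).length ::
      (List.range I.n).flatMap fun v => if mate (v + 1) = 0 then [] else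
        (mate (v + 1) - 1) :: ((r v).length + 1) :: (I.s : ℕ) :: r v) := by
  -- The paths are indexed by their second vertices, with `none` for unmatched ones, so that
  -- `filterMap` lists them in the order in which the program writes them.
  have hP : ∀ v : Fin I.n, ∃ o : Option (I.G.graph.Path I.s I.t × Fin I.q),
      (o = none ↔ mate (v + 1) = 0) ∧ ∀ x ∈ o, I.G.Colored x.1 x.2 ∧
        mate (v + 1) = (x.2 : ℕ) + 1 ∧ (x.1 : I.G.graph.Walk I.s I.t).snd = v ∧
        (x.1 : I.G.graph.Walk I.s I.t).support.map (fun v : Fin _ => (v : ℕ)) =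
          (I.s : ℕ) :: r v := by
    intro v
    by_cases hm : mate (v + 1) = 0
    · exact ⟨none, by simp [hm], by simp⟩
    · obtain ⟨c, hc⟩ : ∃ c, mate (v + 1) = c + 1 := ⟨mate (v + 1) - 1, by omega⟩
      obtain ⟨x, h1, h2, h3, h4⟩ := (h.adj v c hc).exists_path (hr v v.2 c hc)
      refine ⟨some x, by simp [hm], fun y hy => ?_⟩
      obtain rfl : x = y := by simpa using hy
      exact ⟨h1, by omega, Fin.ext h3, h4⟩
  choose P hP0 hP using hP
  have hL : ((List.finRange I.n).filterMap P).Nodup :=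
    (List.nodup_finRange I.n).filterMap fun v w x hx hy =>
      (hP v x hx).2.2.1.symm.trans (hP w x hy).2.2.1
  have hlen : ∀ l : List (Fin I.n), (l.filterMap P).length =
      ((l.map fun v : Fin _ => (v : ℕ)).filter fun v => mate (v + 1) ≠ 0).length := by
    intro l
    induction l with
    | nil => rfl
    | cons v l ih =>
      cases hv : P v with
      | none => simpa [hv, (hP0 v).1 hv] using ih
      | some x => simpa [hv, (hP v x hv).2.1] using ih
  have hflat : ∀ l : List (Fin I.n), ((l.filterMap P).flatMap fun x =>
      (x.2 : ℕ) :: (x.1 : I.G.graph.Walk I.s I.t).support.length ::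
        (x.1 : I.G.graph.Walk I.s I.t).support.map fun v : Fin _ => (v : ℕ)) =
      (l.map fun v : Fin _ => (v : ℕ)).flatMap fun v => if mate (v + 1) = 0 then [] else
        (mate (v + 1) - 1) :: ((r v).length + 1) :: (I.s : ℕ) :: r v := by
    intro l
    induction l with
    | nil => rfl
    | cons v l ih =>
      cases hv : P v with
      | none => simpa [hv, (hP0 v).1 hv] using ih
      | some x =>
        obtain ⟨-, h2, -, h4⟩ := hP v x hv
        have h5 := congrArg List.length h4
        rw [List.length_map, List.length_cons] at h5
        rw [List.filterMap_cons, hv, List.flatMap_cons, ih, h4, h5]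
        simp [h2]
  have hmem : ∀ x ∈ (List.finRange I.n).filterMap P, ∃ v, x ∈ P v := fun x hx => by
    obtain ⟨v, -, hv⟩ := List.mem_filterMap.1 hx
    exact ⟨v, hv⟩
  have hsol : I.G.IsSolution ⟨_, Multiset.coe_nodup.2 hL⟩ := by
    refine EdgeColoredGraph.isSolution_of_snd_ne hT I.s_ne_t ?_ ?_
    · intro x hx
      obtain ⟨v, hv⟩ := hmem x hx
      exact (hP v x hv).1
    · intro x hx y hy hxy
      obtain ⟨v, hv⟩ := hmem x hx
      obtain ⟨w, hw⟩ := hmem y hy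
      obtain ⟨-, a1, a2, -⟩ := hP v x hv
      obtain ⟨-, b1, b2, -⟩ := hP w y hw
      have hvw : v ≠ w := by
        rintro rfl
        exact hxy (Option.mem_unique hv hw)
      -- Equal colors would have the same owner.
      refine ⟨by rwa [a2, b2], fun hc => hvw (Fin.ext ?_)⟩
      rw [← h.owner_iff] at a1 b1
      rw [← hc] at b1
      omega
  have hrange : (List.finRange I.n).map (fun v : Fin _ => (v : ℕ)) = List.range I.n :=
    List.map_coe_finRange_eq_range
  have hcard := hlen (List.finRange I.n)
  rw [hrange] at hcard
  refine ⟨_, (List.finRange I.n).filterMap P, hsol, ⟨⟨_, hsol, rfl⟩, ?_⟩, rfl, ?_⟩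
  · rintro k ⟨S, hS, rfl⟩
    refine (card_le_of_isSolution h hs hA hS).trans (le_of_eq ?_)
    exact hcard.symm
  · rw [Instance.encodePaths_eq, hcard, hflat, hrange]

end MaxCDDP

theorem mainTheorem7 :
    -- MaxCDDP is solvable in polynomial time if the graph without the target is a tree
    RAM.SolvableInPolyTime MaxCDDP.Instance.encode
      (fun I => (I.G.deleteTarget I.t).IsTree) MaxCDDP.Instance.IsOptimalOutput ∧
    -- and, on these instances, solutions correspond to matchings of the bipartite graph
    ∀ I : MaxCDDP.Instance, (I.G.deleteTarget I.t).IsTree →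
      (∀ S : Finset (I.G.graph.Path I.s I.t × Fin I.q), I.G.IsSolution S →
        ∃ M : (I.G.matchingGraph I.s I.t).Subgraph,
          M.IsMatching ∧ I.G.Corresponds S M ∧ M.edgeSet.ncard = S.card) ∧
      (∀ M : (I.G.matchingGraph I.s I.t).Subgraph, M.IsMatching →
        ∃ S : Finset (I.G.graph.Path I.s I.t × Fin I.q),
          I.G.IsSolution S ∧ I.G.Corresponds S M ∧ S.card = M.edgeSet.ncard) ∧
      ∀ h : ℕ, I.G.IsOptimum I.s I.t h ↔
        IsGreatest {k | ∃ M : (I.G.matchingGraph I.s I.t).Subgraph,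
          M.IsMatching ∧ M.edgeSet.ncard = k} h := by
  refine ⟨RAM.solvableInPolyTime_of_stmt MaxCDDP.solve fun I hI => ?_, fun I hI =>
    ⟨fun S hS => hS.exists_matching I.s_ne_t,
      fun M hM => EdgeColoredGraph.exists_solution_of_isMatching hI I.s_ne_t hM,
      EdgeColoredGraph.isOptimum_iff_isGreatest_matching hI I.s_ne_t⟩⟩
  obtain ⟨A, mate, price, owner, r, h1, h2, h3, h4, h5⟩ := MaxCDDP.solve_spec I.isInput
  exact ⟨_, MaxCDDP.isOptimalOutput_of_auction hI h1 h2 h3 h4, h5⟩
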